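/- Let $n$ and $k\ge 2$ be integers, let $[n]=\{1,\dots,n\}$, and let $\binom{[n]}{k}$ denote the collection of all $k$-element subsets of $[n]$. Binomial coefficients with a negative lower entry are $0$. For $\mathcal F\subset\binom{[n]}{k}$ and $x\in[n]$ put $\mathcal F(x)=\{F\setminus\{x\}: x\in F\in\mathcal F\}$, let $\Delta(\mathcal F)=\max_{x\in[n]}|\mathcal F(x)|$ be the maximum degree, and let $\gamma(\mathcal F)=|\mathcal F|-\Delta(\mathcal F)$ be the diversity of $\mathcal F$. For three distinct elements $u,v,w\in[n]$ put $$\mathcal F_{uvw}=\left\{F\in\tbinom{[n]}{k}: |F\cap\{u,v,w\}|=2\right\},\qquad \mathcal F^*_{uvw}=\left\{F\in\tbinom{[n]}{k}: |F\cap\{u,v,w\}|\ge 2\right\}.$$ **Theorem.** Let $\mathcal F\subset\binom{[n]}{k}$ be an intersecting family, i.e. $F\cap F'\neq\emptyset$ for all $F,F'\in\mathcal F$. Define the real number $\alpha$ by $\gamma(\mathcal F)=(1-\alpha)\binom{n-3}{k-2}$, and let $d\ge 36$ be an integer. If $0\le\alpha<1$ and $n\ge\frac{dk}{1-\alpha}$,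 then there exist three distinct elements $u,v,w\in[n]$ such that $$|\mathcal F\setminus\mathcal F^*_{uvw}|\le\frac{d\alpha}{2}\binom{n-d+3}{k-d+3}$$ and $$|\mathcal F_{uvw}\setminus\mathcal F|\le 3\alpha\binom{n-3}{k-2}+\frac{3d\alpha}{2}\binom{n-d+3}{k-d+3}.$$ -/

import Mathlib

namespace Diversity

/-- The binomial coefficient with integer arguments; it vanishes when the lower entry is negative,
and `Ring.choose` is the polynomial `m (m - 1) ⋯ (m - j + 1) / j!` otherwise. -/
noncomputable def binom (m j : ℤ) : ℤ :=
  if 0 ≤ j then Ring.choose m j.toNat else 0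

theorem binom_natCast (m j : ℕ) : binom (m : ℤ) (j : ℤ) = (m.choose j : ℤ) := by
  simp [binom, Ring.choose_natCast]

theorem binom_of_neg (m : ℤ) {j : ℤ} (hj : j < 0) : binom m j = 0 := by
  simp [binom, hj]

/-- The link `𝓕(x) = {F \ {x} : x ∈ F ∈ 𝓕}`. -/
def link {n : ℕ} (𝓕 : Finset (Finset (Fin n))) (x : Fin n) : Finset (Finset (Fin n)) :=
  (𝓕.filter (fun F => x ∈ F)).image (fun F => F \ {x})

/-- The maximum degree `Δ(𝓕) = max_x |𝓕(x)|`. -/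
def maxDegree {n : ℕ} (𝓕 : Finset (Finset (Fin n))) : ℕ :=
  Finset.univ.sup (fun x => (link 𝓕 x).card)

/-- The diversity `γ(𝓕) = |𝓕| - Δ(𝓕)`. -/
def diversity {n : ℕ} (𝓕 : Finset (Finset (Fin n))) : ℤ :=
  (𝓕.card : ℤ) - (maxDegree 𝓕 : ℤ)

/-- All `k`-subsets of the ground set that meet `{u, v, w}` in exactly two elements. -/
def triangleFamily (n k : ℕ) (u v w : Fin n) : Finset (Finset (Fin n)) :=
  (Finset.univ.powersetCard k).filter (fun F => (F ∩ {u, v, w}).card = 2)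

/-- All `k`-subsets of the ground set that meet `{u, v, w}` in at least two elements. -/
def triangleFamilyStar (n k : ℕ) (u v w : Fin n) : Finset (Finset (Fin n)) :=
  (Finset.univ.powersetCard k).filter (fun F => 2 ≤ (F ∩ {u, v, w}).card)

end Diversity

namespace Diversity

open Finset
open scoped FinsetFamily

/-! Write k = κ + 2, N = C(n-3, k-2), E = `chooseSub (n - 2) κ 1` = C(n-2, k-3) and T = `chooseSub
(n - 3) κ 2` = C(n-3, k-4). For n ≥ 36k, T is at most E/36, and 33E is less than 36kN/n. Hence n ≥
dk/(1-α) with d ≥ 36 makes the diversity exceed 33E.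

Call a pair large if more than 4E members contain it. A large pair misses very few members
(`card_members_avoid_pair_le`, by Kruskal–Katona), and when the diversity exceeds 17E/2 it lies in a
triangle of large pairs (`exists_triangle`).

A large pair exists because otherwise `false_of_small_pair_degrees` gives a contradiction. Shift the
family as long as its diversity stays above 17E/2. No shift towards i creates a large pair: such a
pair would contain i and lie in a triangle of large pairs, one of whose sides avoids i. When
shifting gets stuck, either the family is fully shifted, or at most 17E/2 members avoid some pair
{x, y} and the family is shifted off that pair. In both cases the random-walk bound
`card_le_or_card_le_of_shifted` shows that some element is avoided by at most 17E/2 members.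

Given the triangle {u, v, w}, let o count the members outside its star family. Each of the three
classes of F_{uvw} misses at most αN + o sets. Members outside have trace of size at most 1 on the
triangle, so each such class cross-intersects the class of a disjoint pair. Kruskal–Katona bounds
the former in proportion to the sets missing from the latter (`card_le_or_of_crossIntersecting`).
Summing gives o·M ≤ (αN + o)·R with 3R ≤ M, and `le_of_absorb` solves this for o. The second bound
is then 3(αN + o). -/

/-! ### Binomial estimates -/

/-- The binomial coefficient `m.choose (a - s)`, read as `0` when `a < s`. -/
def chooseSub (m a s : ℕ) : ℕ := if s ≤ a then m.choose (a - s) else 0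

theorem chooseSub_succ_succ (m a s : ℕ) :
    chooseSub (m + 1) (a + 1) s = chooseSub m a s + chooseSub m (a + 1) s := by
  unfold chooseSub
  rcases lt_trichotomy s (a + 1) with h | h | h
  · rw [if_pos (by omega), if_pos (by omega), if_pos (by omega),
      show a + 1 - s = (a - s) + 1 by omega, Nat.choose_succ_succ]
  · subst h
    simp
  · rw [if_neg (by omega), if_neg (by omega), if_neg (by omega)]

theorem chooseSub_add (m a s j : ℕ) : chooseSub m (a + j) (s + j) = chooseSub m a s := by
  unfold chooseSub
  simp [Nat.add_sub_add_right]

theorem chooseSub_mono_left {m m' : ℕ} (h : m ≤ m') (a s : ℕ) :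
    chooseSub m a s ≤ chooseSub m' a s := by
  unfold chooseSub
  split_ifs
  · exact Nat.choose_le_choose _ h
  · exact le_rfl

/-- Moving down a diagonal of Pascal's triangle decreases the entries. -/
theorem chooseSub_diag (m a s j : ℕ) : chooseSub m a (s + j) ≤ chooseSub (m + j) a s := by
  induction j generalizing s with
  | zero => exact le_rfl
  | succ j ih =>
    have h1 := ih (s + 1)
    rw [show s + 1 + j = s + (j + 1) by ring] at h1
    refine h1.trans ?_
    unfold chooseSub
    split_ifs with h2 h3
    · rw [← add_assoc, show a - s = (a - (s + 1)) + 1 by omega, Nat.choose_succ_succ]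
      exact Nat.le_add_right _ _
    · omega
    · exact Nat.zero_le _
    · exact le_rfl

theorem choose_le_choose_of_half {m j : ℕ} : ∀ {i : ℕ}, j ≤ i → 2 * i ≤ m →
    m.choose j ≤ m.choose i := by
  intro i hi
  induction i, hi using Nat.le_induction with
  | base => intro _; exact le_rfl
  | succ i hi ih =>
    intro h
    exact (ih (by omega)).trans (Nat.choose_le_succ_of_lt_half_left (by omega))

/-- Unimodality of a row of Pascal's triangle: `j` lies between `a` and its mirror image `m - a`. -/
theorem choose_le_of_between {m a j : ℕ} (ham : a ≤ m) (h1 : m - a ≤ j) (h2 : j ≤ a) :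
    m.choose a ≤ m.choose j := by
  rw [← Nat.choose_symm ham]
  rcases le_or_gt (2 * j) m with h | h
  · exact choose_le_choose_of_half h1 h
  · rw [← Nat.choose_symm (h2.trans ham)]
    exact choose_le_choose_of_half (by omega) (by omega)

theorem choose_le_chooseSub {m a s : ℕ} (ham : a ≤ m) (h : m + s ≤ 2 * a) :
    m.choose a ≤ chooseSub m a s := by
  unfold chooseSub
  rw [if_pos (by omega)]
  exact choose_le_of_between ham (by omega) (by omega)

/-! ### Traces, shiftedness and cross-intersection -/

variable {n : ℕ}

/-- Any member of one family meets any member of the other in at least `t` elements. -/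
def CrossIntersecting (t : ℕ) (𝒜 ℬ : Finset (Finset (Fin n))) : Prop :=
  ∀ A ∈ 𝒜, ∀ B ∈ ℬ, t ≤ (A ∩ B).card

/-- All members are `a`-element subsets of `V`. -/
def UniformOn (V : Finset (Fin n)) (a : ℕ) (𝒜 : Finset (Finset (Fin n))) : Prop :=
  ∀ A ∈ 𝒜, A ⊆ V ∧ A.card = a

/-- The family is closed under replacing an element of `V` by a smaller element of `V`. -/
def ShiftedOn (V : Finset (Fin n)) (𝒜 : Finset (Finset (Fin n))) : Prop :=
  ∀ i ∈ V, ∀ j ∈ V, i < j → ∀ A ∈ 𝒜, j ∈ A → i ∉ A → insert i (A.erase j) ∈ 𝒜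

/-- The members that contain `P` and avoid `Q`. -/
def members (𝒜 : Finset (Finset (Fin n))) (P Q : Finset (Fin n)) : Finset (Finset (Fin n)) :=
  𝒜.filter (fun A => P ⊆ A ∧ Disjoint A Q)

/-- The members that contain `P` and avoid `Q`, with `P` removed. -/
def trace (𝒜 : Finset (Finset (Fin n))) (P Q : Finset (Fin n)) : Finset (Finset (Fin n)) :=
  (members 𝒜 P Q).image (fun A => A \ P)

theorem mem_members {𝒜 : Finset (Finset (Fin n))} {P Q A : Finset (Fin n)} :
    A ∈ members 𝒜 P Q ↔ A ∈ 𝒜 ∧ P ⊆ A ∧ Disjoint A Q := by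
  simp [members]

theorem card_trace (𝒜 : Finset (Finset (Fin n))) (P Q : Finset (Fin n)) :
    (trace 𝒜 P Q).card = (members 𝒜 P Q).card := by
  apply Finset.card_image_of_injOn
  intro A hA B hB h
  have hA' := (mem_members.1 hA).2.1
  have hB' := (mem_members.1 hB).2.1
  have h' : A \ P = B \ P := h
  rw [← Finset.sdiff_union_of_subset hA', ← Finset.sdiff_union_of_subset hB', h']

theorem mem_trace {𝒜 : Finset (Finset (Fin n))} {P Q S : Finset (Fin n)} (hPQ : Disjoint P Q) :
    S ∈ trace 𝒜 P Q ↔ S ∪ P ∈ 𝒜 ∧ Disjoint S P ∧ Disjoint S Q := by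
  simp only [trace, mem_image, mem_members]
  constructor
  · rintro ⟨A, ⟨hA, hP, hQ⟩, rfl⟩
    rw [Finset.sdiff_union_of_subset hP]
    exact ⟨hA, Finset.sdiff_disjoint, hQ.mono_left Finset.sdiff_subset⟩
  · rintro ⟨h, hP, hQ⟩
    refine ⟨S ∪ P, ⟨h, Finset.subset_union_right, Finset.disjoint_union_left.2 ⟨hQ, hPQ⟩⟩, ?_⟩
    rw [Finset.union_sdiff_right, Finset.sdiff_eq_self_of_disjoint hP]

theorem card_members_split (𝒜 : Finset (Finset (Fin n))) (P Q : Finset (Fin n)) (z : Fin n) :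
    (members 𝒜 P Q).card =
      (members 𝒜 (insert z P) Q).card + (members 𝒜 P (insert z Q)).card := by
  rw [← Finset.card_filter_add_card_filter_not (s := members 𝒜 P Q) (fun A => z ∈ A)]
  congr 2
  · ext A
    simp only [mem_filter, mem_members, Finset.insert_subset_iff]
    tauto
  · ext A
    simp only [mem_filter, mem_members, Finset.disjoint_insert_right]
    tauto

theorem card_members_trace (𝒜 : Finset (Finset (Fin n))) {P Q P' Q' : Finset (Fin n)}
    (hP : Disjoint P P') (hQ : Disjoint P Q') :
    (members (trace 𝒜 P Q) P' Q').card = (members 𝒜 (P ∪ P') (Q ∪ Q')).card := by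
  have h : members (trace 𝒜 P Q) P' Q' =
      (members 𝒜 (P ∪ P') (Q ∪ Q')).image (fun A => A \ P) := by
    ext S
    simp only [trace, mem_members, mem_image]
    constructor
    · rintro ⟨⟨A, ⟨hA, hPA, hQA⟩, rfl⟩, hP', hQ'⟩
      refine ⟨A, ⟨hA, Finset.union_subset hPA (hP'.trans Finset.sdiff_subset),
        Finset.disjoint_union_right.2 ⟨hQA, ?_⟩⟩, rfl⟩
      rw [Finset.disjoint_left] at hQ' hQ ⊢
      intro x hx hxQ
      exact hQ' (Finset.mem_sdiff.2 ⟨hx, fun h => hQ h hxQ⟩) hxQ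
    · rintro ⟨A, ⟨hA, hPA, hQA⟩, rfl⟩
      rw [Finset.disjoint_union_right] at hQA
      refine ⟨⟨A, ⟨hA, Finset.subset_union_left.trans hPA, hQA.1⟩, rfl⟩, ?_,
        hQA.2.mono_left Finset.sdiff_subset⟩
      intro x hx
      exact Finset.mem_sdiff.2 ⟨hPA (Finset.mem_union_right _ hx),
        Finset.disjoint_right.1 hP hx⟩
  rw [h]
  apply Finset.card_image_of_injOn
  intro A hA B hB h
  have hA' := Finset.subset_union_left.trans (mem_members.1 hA).2.1
  have hB' := Finset.subset_union_left.trans (mem_members.1 hB).2.1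
  have h' : A \ P = B \ P := h
  rw [← Finset.sdiff_union_of_subset hA', ← Finset.sdiff_union_of_subset hB', h']

theorem members_mono (𝒜 : Finset (Finset (Fin n))) {P P' Q Q' : Finset (Fin n)}
    (hP : P' ⊆ P) (hQ : Q' ⊆ Q) : members 𝒜 P Q ⊆ members 𝒜 P' Q' := by
  intro A hA
  rw [mem_members] at hA ⊢
  exact ⟨hA.1, hP.trans hA.2.1, hA.2.2.mono_right hQ⟩

theorem card_members_mono (𝒜 : Finset (Finset (Fin n))) {P P' Q Q' : Finset (Fin n)}
    (hP : P' ⊆ P) (hQ : Q' ⊆ Q) : (members 𝒜 P Q).card ≤ (members 𝒜 P' Q').card :=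
  Finset.card_le_card (members_mono 𝒜 hP hQ)

theorem members_empty (𝒜 : Finset (Finset (Fin n))) : members 𝒜 ∅ ∅ = 𝒜 := by
  ext A
  simp [mem_members]

theorem UniformOn.trace {V W P Q : Finset (Fin n)} {a b : ℕ} {𝒜 : Finset (Finset (Fin n))}
    (h : UniformOn V a 𝒜) (hb : a = b + P.card) (hW : V \ (P ∪ Q) = W) :
    UniformOn W b (Diversity.trace 𝒜 P Q) := by
  subst hW
  intro S hS
  simp only [Diversity.trace, mem_image, mem_members] at hS
  obtain ⟨A, ⟨hA, hP, hQ⟩, rfl⟩ := hS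
  refine ⟨?_, ?_⟩
  · intro x hx
    rw [Finset.mem_sdiff] at hx
    rw [Finset.mem_sdiff, Finset.mem_union]
    exact ⟨(h A hA).1 hx.1, fun h' => h'.elim hx.2 (Finset.disjoint_left.1 hQ hx.1)⟩
  · rw [Finset.card_sdiff_of_subset hP, (h A hA).2]
    omega

theorem ShiftedOn.trace {V W P Q : Finset (Fin n)} {𝒜 : Finset (Finset (Fin n))}
    (h : ShiftedOn V 𝒜) (hPQ : Disjoint P Q) (hW : V \ (P ∪ Q) = W) :
    ShiftedOn W (Diversity.trace 𝒜 P Q) := by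
  subst hW
  intro i hi j hj hij S hS hjS hiS
  rw [mem_trace hPQ] at hS ⊢
  simp only [Finset.mem_sdiff, Finset.mem_union, not_or] at hi hj
  obtain ⟨hS, hSP, hSQ⟩ := hS
  have := h i hi.1 j hj.1 hij _ hS (Finset.mem_union_left _ hjS)
    (by simp [hiS, hi.2.1])
  refine ⟨?_, ?_, ?_⟩
  · convert this using 1
    rw [Finset.erase_union_distrib, Finset.erase_eq_of_notMem hj.2.1, Finset.insert_union]
  · rw [Finset.disjoint_insert_left]
    exact ⟨hi.2.1, hSP.mono_left (Finset.erase_subset _ _)⟩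
  · rw [Finset.disjoint_insert_left]
    exact ⟨hi.2.2, hSQ.mono_left (Finset.erase_subset _ _)⟩

theorem CrossIntersecting.symm {t : ℕ} {𝒜 ℬ : Finset (Finset (Fin n))}
    (h : CrossIntersecting t 𝒜 ℬ) : CrossIntersecting t ℬ 𝒜 := by
  intro B hB A hA
  rw [Finset.inter_comm]
  exact h A hA B hB

/-- Traces on sets `P`, `P'` of a cross-`(t + |P ∩ P'|)`-intersecting pair are
cross-`t`-intersecting. -/
theorem CrossIntersecting.trace {t s : ℕ} {𝒜 ℬ : Finset (Finset (Fin n))}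
    {P Q P' Q' : Finset (Fin n)} (h : CrossIntersecting t 𝒜 ℬ)
    (hPQ : Disjoint P Q) (hPQ' : Disjoint P' Q') (h1 : P' ⊆ P ∪ Q) (h2 : P ⊆ P' ∪ Q')
    (ht : t = s + (P ∩ P').card) :
    CrossIntersecting s (Diversity.trace 𝒜 P Q) (Diversity.trace ℬ P' Q') := by
  intro S hS S' hS'
  rw [mem_trace hPQ] at hS
  rw [mem_trace hPQ'] at hS'
  have h3 := h _ hS.1 _ hS'.1
  have h4 : (S ∪ P) ∩ (S' ∪ P') ⊆ (S ∩ S') ∪ (P ∩ P') := by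
    intro x hx
    simp only [Finset.mem_inter, Finset.mem_union] at hx ⊢
    obtain ⟨h5 | h5, h6 | h6⟩ := hx
    · exact Or.inl ⟨h5, h6⟩
    · rcases Finset.mem_union.1 (h1 h6) with h7 | h7
      · exact absurd h7 (Finset.disjoint_left.1 hS.2.1 h5)
      · exact absurd h7 (Finset.disjoint_left.1 hS.2.2 h5)
    · rcases Finset.mem_union.1 (h2 h5) with h7 | h7
      · exact absurd h7 (Finset.disjoint_left.1 hS'.2.1 h6)
      · exact absurd h7 (Finset.disjoint_left.1 hS'.2.2 h6)
    · exact Or.inr ⟨h5, h6⟩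
  have h7 := (Finset.card_le_card h4).trans (Finset.card_union_le _ _)
  omega

/-- In shifted families, members that avoid the first element intersect in one more element. -/
theorem CrossIntersecting.succ_of_shifted {t : ℕ} {V : Finset (Fin n)}
    {𝒜 ℬ : Finset (Finset (Fin n))} {v : Fin n} (h : CrossIntersecting t 𝒜 ℬ) (ht : 1 ≤ t)
    (hV : ∀ A ∈ 𝒜, A ⊆ V) (hs : ShiftedOn V 𝒜) (hv : v ∈ V) (hmin : ∀ x ∈ V, v ≤ x) :
    CrossIntersecting (t + 1) (Diversity.trace 𝒜 ∅ {v}) (Diversity.trace ℬ ∅ {v}) := by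
  intro A hA B hB
  rw [mem_trace (Finset.disjoint_empty_left _)] at hA hB
  simp only [Finset.union_empty, Finset.disjoint_singleton_right] at hA hB
  have h1 := h A hA.1 B hB.1
  by_contra h2
  have h3 : (A ∩ B).card = t := by omega
  obtain ⟨z, hz⟩ : (A ∩ B).Nonempty := by
    rw [← Finset.card_pos]
    omega
  rw [Finset.mem_inter] at hz
  have hzV := hV A hA.1 hz.1
  have hvz : v < z := lt_of_le_of_ne (hmin z hzV) (by rintro rfl; exact hA.2.2 hz.1)
  have h4 := h _ (hs v hv z hzV hvz A hA.1 hz.1 hA.2.2) B hB.1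
  -- Exchanging `z` for `v` in `A` removes a common element and creates none, because `v ∉ B`. So
  -- the two sets would meet in only `t - 1` elements.
  have h5 : insert v (A.erase z) ∩ B ⊆ (A ∩ B).erase z := by
    intro x hx
    simp only [Finset.mem_inter, Finset.mem_insert, Finset.mem_erase] at hx ⊢
    rcases hx.1 with rfl | h6
    · exact absurd hx.2 hB.2.2
    · exact ⟨h6.1, h6.2, hx.2⟩
  have h6 := Finset.card_le_card h5
  rw [Finset.card_erase_of_mem (Finset.mem_inter.2 hz)] at h6
  omega

theorem UniformOn.card_le {V : Finset (Fin n)} {a : ℕ} {𝒜 : Finset (Finset (Fin n))}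
    (h : UniformOn V a 𝒜) : 𝒜.card ≤ V.card.choose a := by
  rw [← Finset.card_powersetCard]
  exact Finset.card_le_card fun A hA => Finset.mem_powersetCard.2 (h A hA)

theorem UniformOn.le_card {V : Finset (Fin n)} {a : ℕ} {𝒜 : Finset (Finset (Fin n))}
    (h : UniformOn V a 𝒜) (hne : 𝒜.Nonempty) : a ≤ V.card := by
  obtain ⟨A, hA⟩ := hne
  rw [← (h A hA).2]
  exact Finset.card_le_card (h A hA).1

/-! ### The random-walk bound for shifted families -/

theorem chooseSub_zero (m a : ℕ) : chooseSub m a 0 = m.choose a := by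
  simp [chooseSub]

/-- Removing the last element of the ground set from a pair of shifted cross-`t`-intersecting
families leaves cross-`t`-intersecting families. -/
theorem CrossIntersecting.trace_max {t a b : ℕ} {V : Finset (Fin n)}
    {𝒜 ℬ : Finset (Finset (Fin n))} {v : Fin n} (h : CrossIntersecting t 𝒜 ℬ)
    (hV : v ∉ V) (hmax : ∀ x ∈ V, x < v) (h𝒜 : UniformOn (insert v V) a 𝒜)
    (hℬ : UniformOn (insert v V) b ℬ) (hs : ShiftedOn (insert v V) 𝒜)
    (hab : a + b < (insert v V).card + t) :
    CrossIntersecting t (Diversity.trace 𝒜 {v} ∅) (Diversity.trace ℬ {v} ∅) := by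
  intro A hA B hB
  rw [mem_trace (Finset.disjoint_empty_right _)] at hA hB
  simp only [Finset.disjoint_singleton_right, Finset.disjoint_empty_right, and_true] at hA hB
  obtain ⟨hA, hvA⟩ := hA
  obtain ⟨hB, hvB⟩ := hB
  by_contra h2
  have h1 := h _ hA _ hB
  have h4 : (A ∪ {v}) ∩ (B ∪ {v}) = (A ∩ B) ∪ {v} := by
    ext x
    simp only [Finset.mem_inter, Finset.mem_union]
    tauto
  -- Since `a + b` is less than the size of the ground set plus `t`, the two sets do not cover it.
  -- Exchanging `v` for an uncovered `c` in the first set removes `v` from the intersection.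
  have hcard : ((A ∪ {v}) ∪ (B ∪ {v})).card < (insert v V).card := by
    have := Finset.card_union_add_card_inter (A ∪ {v}) (B ∪ {v})
    rw [(h𝒜 _ hA).2, (hℬ _ hB).2] at this
    omega
  obtain ⟨c, hc, hc'⟩ := Finset.exists_mem_notMem_of_card_lt_card hcard
  simp only [Finset.mem_union, Finset.mem_singleton, not_or] at hc'
  have hcV : c ∈ V := by
    rcases Finset.mem_insert.1 hc with rfl | h5
    · exact absurd rfl hc'.1.2
    · exact h5
  have h5 := hs c hc v (Finset.mem_insert_self _ _) (hmax c hcV) _ hA (by simp)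
    (by simp only [Finset.mem_union, Finset.mem_singleton, not_or]; exact hc'.1)
  have h6 := h _ h5 _ hB
  apply h2
  refine h6.trans (Finset.card_le_card ?_)
  intro x hx
  simp only [Finset.mem_inter, Finset.mem_insert, Finset.mem_erase, Finset.mem_union,
    Finset.mem_singleton] at hx ⊢
  obtain ⟨rfl | ⟨h7, h8⟩, h9⟩ := hx
  · rcases h9 with h9 | h9
    · exact absurd h9 hc'.2.1
    · exact absurd h9 hc'.1.2
  · tauto

theorem card_eq_trace_add_trace (𝒜 : Finset (Finset (Fin n))) (v : Fin n) :
    𝒜.card = (trace 𝒜 {v} ∅).card + (trace 𝒜 ∅ {v}).card := by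
  rw [card_trace, card_trace]
  conv_lhs => rw [← members_empty 𝒜, card_members_split 𝒜 ∅ ∅ v]
  simp

/-- Shifted cross-`t`-intersecting families obey the bound of a random walk hitting the line
`y = x + s`, respectively `y = x + s'`. -/
theorem card_le_or_card_le_of_shifted (V : Finset (Fin n)) : ∀ (a b t s s' : ℕ)
    (𝒜 ℬ : Finset (Finset (Fin n))), UniformOn V a 𝒜 → UniformOn V b ℬ → ShiftedOn V 𝒜 →
    ShiftedOn V ℬ → CrossIntersecting t 𝒜 ℬ → s + s' ≤ 2 * t + 1 →
    𝒜.card ≤ chooseSub V.card a s ∨ ℬ.card ≤ chooseSub V.card b s' := by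
  induction V using Finset.induction_on_max with
  | empty =>
    intro a b t s s' 𝒜 ℬ h𝒜 hℬ hs𝒜 hsℬ hc hs
    rcases 𝒜.eq_empty_or_nonempty with rfl | ⟨A, hA⟩
    · simp
    rcases ℬ.eq_empty_or_nonempty with rfl | ⟨B, hB⟩
    · simp
    have h1 := hc A hA B hB
    rw [Finset.subset_empty.1 (h𝒜 A hA).1, Finset.empty_inter, Finset.card_empty] at h1
    obtain rfl | rfl : s = 0 ∨ s' = 0 := by omega
    · left; rw [chooseSub_zero]; exact h𝒜.card_le
    · right; rw [chooseSub_zero]; exact hℬ.card_le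
  | insert v V hmax ih =>
    intro a b t s s' 𝒜 ℬ h𝒜 hℬ hs𝒜 hsℬ hc hs
    have hvV : v ∉ V := fun h => lt_irrefl _ (hmax v h)
    rcases 𝒜.eq_empty_or_nonempty with rfl | ⟨A, hA⟩
    · simp
    rcases ℬ.eq_empty_or_nonempty with rfl | ⟨B, hB⟩
    · simp
    have haV := h𝒜.le_card ⟨A, hA⟩
    have hbV := hℬ.le_card ⟨B, hB⟩
    -- Here `s + s' ≤ 2 * t + 1` forces one of the two target bounds to be no smaller than the
    -- number of all sets of that size, so the trivial bound suffices.
    by_cases hab : (insert v V).card + t ≤ a + b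
    · by_cases h : (insert v V).card + s ≤ 2 * a
      · left; exact h𝒜.card_le.trans (choose_le_chooseSub haV h)
      · right; exact hℬ.card_le.trans (choose_le_chooseSub hbV (by omega))
    rcases Nat.eq_zero_or_pos t with rfl | ht
    · obtain rfl | rfl : s = 0 ∨ s' = 0 := by omega
      · left; rw [chooseSub_zero]; exact h𝒜.card_le
      · right; rw [chooseSub_zero]; exact hℬ.card_le
    have hta : t ≤ a := by
      rw [← (h𝒜 A hA).2]
      exact (hc A hA B hB).trans (Finset.card_le_card Finset.inter_subset_left)
    have htb : t ≤ b := by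
      rw [← (hℬ B hB).2]
      exact (hc A hA B hB).trans (Finset.card_le_card Finset.inter_subset_right)
    obtain ⟨a, rfl⟩ : ∃ a', a = a' + 1 := ⟨a - 1, by omega⟩
    obtain ⟨b, rfl⟩ : ∃ b', b = b' + 1 := ⟨b - 1, by omega⟩
    have hV1 : insert v V \ ({v} ∪ ∅) = V := by
      ext x; simp only [mem_sdiff, mem_insert, mem_union, mem_singleton, notMem_empty, or_false]
      constructor
      · tauto
      · intro h; exact ⟨Or.inr h, by rintro rfl; exact hvV h⟩
    have hV0 : insert v V \ (∅ ∪ {v}) = V := by rw [Finset.union_comm, hV1]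
    have u𝒜1 := h𝒜.trace (b := a) (by simp) hV1
    have u𝒜0 := h𝒜.trace (b := a + 1) (by simp) hV0
    have uℬ1 := hℬ.trace (b := b) (by simp) hV1
    have uℬ0 := hℬ.trace (b := b + 1) (by simp) hV0
    have s𝒜1 := hs𝒜.trace (by simp) hV1
    have s𝒜0 := hs𝒜.trace (by simp) hV0
    have sℬ1 := hsℬ.trace (by simp) hV1
    have sℬ0 := hsℬ.trace (by simp) hV0
    have c11 := hc.trace_max hvV hmax h𝒜 hℬ hs𝒜 (by omega)
    have c10 := hc.trace (s := t) (P := {v}) (Q := ∅) (P' := ∅) (Q' := {v}) (by simp) (by simp)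
      (by simp) (by simp) (by simp)
    have c01 := hc.trace (s := t) (P := ∅) (Q := {v}) (P' := {v}) (Q' := ∅) (by simp) (by simp)
      (by simp) (by simp) (by simp)
    have c00 := hc.trace (s := t) (P := ∅) (Q := {v}) (P' := ∅) (Q' := {v}) (by simp) (by simp)
      (by simp) (by simp) (by simp)
    -- The alternative holds for each of the four pairings of a trace of `𝒜` with a trace of `ℬ`.
    -- Hence it holds for both traces of `𝒜` or for both traces of `ℬ`, and Pascal's rule adds the
    -- two bounds.
    have i11 := ih _ _ _ s s' _ _ u𝒜1 uℬ1 s𝒜1 sℬ1 c11 hs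
    have i10 := ih _ _ _ s s' _ _ u𝒜1 uℬ0 s𝒜1 sℬ0 c10 hs
    have i01 := ih _ _ _ s s' _ _ u𝒜0 uℬ1 s𝒜0 sℬ1 c01 hs
    have i00 := ih _ _ _ s s' _ _ u𝒜0 uℬ0 s𝒜0 sℬ0 c00 hs
    have e1 := card_eq_trace_add_trace 𝒜 v
    have e2 := card_eq_trace_add_trace ℬ v
    rw [Finset.card_insert_of_notMem hvV, chooseSub_succ_succ, chooseSub_succ_succ]
    omega

/-! ### Kruskal–Katona bounds for cross-intersecting families -/

/-- Starting from all `r`-sets, the colexicographically largest set is removed repeatedly. -/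
theorem exists_isInitSeg_card_eq (m r : ℕ) : ∀ j ≤ m.choose r,
    ∃ 𝒞 : Finset (Finset (Fin m)), Colex.IsInitSeg 𝒞 r ∧ 𝒞.card = j := by
  intro j hj
  induction hj using Nat.decreasingInduction with
  | self =>
    refine ⟨powersetCard r univ, ⟨Set.sized_powersetCard _ _, ?_⟩, by simp⟩
    rintro s t - ⟨-, ht⟩
    simp [mem_powersetCard, ht]
  | of_succ j hj ih =>
    obtain ⟨𝒞, h𝒞, hcard⟩ := ih
    have hne : 𝒞.Nonempty := by
      rw [← Finset.card_pos]
      omega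
    obtain ⟨s, hs, hmax⟩ := Finset.exists_max_image 𝒞 toColex hne
    refine ⟨𝒞.erase s, ⟨?_, ?_⟩, by rw [Finset.card_erase_of_mem hs]; omega⟩
    · exact h𝒞.1.mono (by simp)
    · intro a t ha ht
      rw [Finset.mem_erase] at ha ⊢
      refine ⟨?_, h𝒞.2 ha.2 ht⟩
      rintro rfl
      exact absurd ht.1 (not_lt.2 (hmax a ha.2))

theorem isInitSeg_powersetCard_attachFin {m q : ℕ} (hq : q ≤ m) (r : ℕ) :
    Colex.IsInitSeg (powersetCard r
      (attachFin (range q) fun _ h => (mem_range.1 h).trans_le hq : Finset (Fin m))) r := by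
  refine ⟨Set.sized_powersetCard _ _, ?_⟩
  simp_rw [mem_powersetCard]
  rintro A B hA ⟨hB1, hB2⟩
  refine ⟨fun t ht => ?_, hB2⟩
  rw [mem_attachFin, mem_range]
  have h : toColex (image Fin.val B) < toColex (image Fin.val A) := by
    rwa [Colex.toColex_image_lt_toColex_image Fin.val_strictMono]
  apply Colex.forall_lt_mono h.le _ t (mem_image.2 ⟨t, ht, rfl⟩)
  simp_rw [mem_image]
  rintro _ ⟨a, ha, rfl⟩
  have := hA.1 ha
  rwa [mem_attachFin, mem_range] at this

/-- Local LYM inequality for iterated shadows, inside a ground set `R`. -/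
theorem card_mul_choose_le_card_shadow_mul {m r i : ℕ} {R : Finset (Fin m)}
    {𝒞 : Finset (Finset (Fin m))} (h : 𝒞 ⊆ powersetCard r R) (hir : i ≤ r) :
    𝒞.card * R.card.choose (r - i) ≤ (∂^[i] 𝒞).card * R.card.choose r := by
  rcases 𝒞.eq_empty_or_nonempty with rfl | ⟨C, hC⟩
  · simp
  have hrR : r ≤ R.card := by
    have := mem_powersetCard.1 (h hC)
    rw [← this.2]
    exact card_le_card this.1
  have hmem : ∀ S ∈ 𝒞, S ⊆ R ∧ S.card = r := fun S hS => mem_powersetCard.1 (h hS)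
  -- Double counting of the pairs formed by a member and one of its `(r - i)`-subsets.
  have key : 𝒞.card * r.choose (r - i) ≤
      (∂^[i] 𝒞).card * (R.card - (r - i)).choose i := by
    apply Finset.card_mul_le_card_mul (fun S T => T ⊆ S)
    · intro S hS
      have h1 : powersetCard (r - i) S ⊆ (∂^[i] 𝒞).bipartiteAbove (fun S T => T ⊆ S) S := by
        intro T hT
        rw [mem_powersetCard] at hT
        rw [mem_bipartiteAbove]
        refine ⟨mem_shadow_iterate_iff_exists_sdiff.2 ⟨S, hS, hT.1, ?_⟩, hT.1⟩
        rw [card_sdiff_of_subset hT.1, (hmem S hS).2, hT.2]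
        omega
      have h2 := card_le_card h1
      rwa [card_powersetCard, (hmem S hS).2] at h2
    · intro T hT
      obtain ⟨S0, hS0, hTS0, hcard0⟩ := mem_shadow_iterate_iff_exists_sdiff.1 hT
      have hTR : T ⊆ R := hTS0.trans (hmem S0 hS0).1
      have hTcard : T.card = r - i := by
        rw [card_sdiff_of_subset hTS0, (hmem S0 hS0).2] at hcard0
        have := card_le_card hTS0
        rw [(hmem S0 hS0).2] at this
        omega
      have h1 : (𝒞.bipartiteBelow (fun S T => T ⊆ S) T).card ≤ (powersetCard i (R \ T)).card := by
        apply card_le_card_of_injOn (fun S => S \ T)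
        · intro S hS
          simp only [Finset.mem_coe, mem_bipartiteBelow] at hS
          simp only [Finset.mem_coe, mem_powersetCard]
          refine ⟨sdiff_subset_sdiff (hmem S hS.1).1 le_rfl, ?_⟩
          rw [card_sdiff_of_subset hS.2, (hmem S hS.1).2, hTcard]
          omega
        · intro S hS S' hS' hSS'
          simp only [Finset.mem_coe, mem_bipartiteBelow] at hS hS'
          have hSS'' : S \ T = S' \ T := hSS'
          rw [← sdiff_union_of_subset hS.2, ← sdiff_union_of_subset hS'.2, hSS'']
      rwa [card_powersetCard, card_sdiff_of_subset hTR, hTcard] at h1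
  have hmul := Nat.choose_mul (n := R.card) (k := r) (s := r - i) (Nat.sub_le _ _)
  rw [Nat.sub_sub_self hir] at hmul
  have hpos : 0 < r.choose (r - i) := Nat.choose_pos (Nat.sub_le _ _)
  apply Nat.le_of_mul_le_mul_right _ hpos
  calc 𝒞.card * R.card.choose (r - i) * r.choose (r - i)
      = 𝒞.card * r.choose (r - i) * R.card.choose (r - i) := by ring
    _ ≤ (∂^[i] 𝒞).card * (R.card - (r - i)).choose i * R.card.choose (r - i) :=
        Nat.mul_le_mul_right _ key
    _ = (∂^[i] 𝒞).card * (R.card.choose (r - i) * (R.card - (r - i)).choose i) := by ring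
    _ = (∂^[i] 𝒞).card * R.card.choose r * r.choose (r - i) := by rw [← hmul]; ring

/-- Kruskal–Katona combined with the local LYM inequality: a family either has an iterated shadow
at least as large as that of all subsets of a `q`-set, or it is no denser than its iterated shadow
inside a `q`-set. -/
theorem choose_le_card_shadow_or_card_mul_le {m r i q : ℕ} {𝒜 : Finset (Finset (Fin m))}
    (h : (𝒜 : Set (Finset (Fin m))).Sized r) (hir : i ≤ r) (hq : q ≤ m) :
    q.choose (r - i) ≤ (∂^[i] 𝒜).card ∨
      𝒜.card * q.choose (r - i) ≤ (∂^[i] 𝒜).card * q.choose r := by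
  rcases 𝒜.eq_empty_or_nonempty with rfl | ⟨A, hA⟩
  · right; simp
  have hrm : r ≤ m := by
    rw [← h hA]
    exact card_finset_fin_le A
  rcases lt_or_ge q r with hqr | hqr
  · left
    have h1 := kruskal_katona_lovasz_form hir le_rfl hrm h
      (by rw [Nat.choose_self]; exact card_pos.2 ⟨A, hA⟩)
    exact (Nat.choose_le_choose _ hqr.le).trans h1
  rcases le_or_gt (q.choose r) 𝒜.card with hc | hc
  · left
    exact kruskal_katona_lovasz_form hir hqr hq h hc
  right
  -- The colex initial segment of the same size has an iterated shadow no larger than that of `𝒜`.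
  -- It is small enough to lie in a `q`-set, where the local LYM inequality applies.
  obtain ⟨𝒞, h𝒞, hcard⟩ := exists_isInitSeg_card_eq m r 𝒜.card
    (hc.le.trans (Nat.choose_le_choose _ hq))
  set R : Finset (Fin m) := attachFin (range q) fun _ h => (mem_range.1 h).trans_le hq with hR
  have hRcard : R.card = q := by rw [hR, card_attachFin, card_range]
  have hsub : 𝒞 ⊆ powersetCard r R := by
    rcases h𝒞.total (isInitSeg_powersetCard_attachFin hq r) with h1 | h1
    · exact h1
    · have h2 := card_le_card h1
      rw [card_powersetCard, hRcard] at h2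
      omega
  have h1 := card_mul_choose_le_card_shadow_mul hsub hir
  rw [hRcard, hcard] at h1
  exact h1.trans (Nat.mul_le_mul_right _ (iterated_kk h hcard.le h𝒞))

/-- No `a`-subset of the complement of a member of `ℬ` belongs to `𝒜`. So the shadow of the
complements on level `a` is at most the number of sets missing from `𝒜`, and bounding it from below
bounds `ℬ`. -/
theorem card_le_or_of_crossIntersecting_univ {m a b q : ℕ} {𝒜 ℬ : Finset (Finset (Fin m))}
    (h𝒜 : UniformOn univ a 𝒜) (hℬ : UniformOn univ b ℬ) (hc : CrossIntersecting 1 𝒜 ℬ)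
    (hab : a + b ≤ m) (hq : q ≤ m) :
    q.choose a ≤ m.choose a - 𝒜.card ∨
      ℬ.card * q.choose a ≤ (m.choose a - 𝒜.card) * q.choose (m - b) := by
  have hsized : (ℬᶜˢ : Set (Finset (Fin m))).Sized (m - b) := by
    have : (ℬ : Set (Finset (Fin m))).Sized b := fun B hB => (hℬ B hB).2
    simpa using this.compls
  set i := m - b - a with hi
  have hra : m - b - i = a := by omega
  have hle : (∂^[i] ℬᶜˢ).card ≤ m.choose a - 𝒜.card := by
    have hdisj : Disjoint (∂^[i] ℬᶜˢ) 𝒜 := by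
      rw [Finset.disjoint_left]
      intro S hS hS'
      obtain ⟨T, hT, hST, -⟩ := mem_shadow_iterate_iff_exists_sdiff.1 hS
      rw [mem_compls] at hT
      have h1 := hc S hS' _ hT
      have h2 : S ∩ Tᶜ = ∅ := by
        rw [← Finset.disjoint_iff_inter_eq_empty]
        exact disjoint_compl_right.mono_left hST
      rw [h2] at h1
      simp at h1
    have hu : UniformOn univ a (∂^[i] ℬᶜˢ ∪ 𝒜) := by
      intro S hS
      refine ⟨subset_univ _, ?_⟩
      rcases mem_union.1 hS with h1 | h1
      · have := hsized.shadow_iterate (k := i) (by simpa using h1)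
        omega
      · exact (h𝒜 S h1).2
    have h1 := hu.card_le
    rw [card_union_of_disjoint hdisj, card_univ, Fintype.card_fin] at h1
    omega
  have h1 := choose_le_card_shadow_or_card_mul_le (i := i) (q := q) (𝒜 := ℬᶜˢ) hsized
    (by omega) hq
  rw [hra, card_compls] at h1
  rcases h1 with h1 | h1
  · exact Or.inl (h1.trans hle)
  · exact Or.inr (h1.trans (Nat.mul_le_mul_right _ hle))

/-- Cross-intersecting families on a ground set `V`: either many `a`-sets are missing from `𝒜`, or
the size of `ℬ` is bounded proportionally to their number. -/
theorem card_le_or_of_crossIntersecting {n a b q : ℕ} {V : Finset (Fin n)}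
    {𝒜 ℬ : Finset (Finset (Fin n))}
    (h𝒜 : UniformOn V a 𝒜) (hℬ : UniformOn V b ℬ) (hc : CrossIntersecting 1 𝒜 ℬ)
    (hab : a + b ≤ V.card) (hq : q ≤ V.card) :
    q.choose a ≤ V.card.choose a - 𝒜.card ∨
      ℬ.card * q.choose a ≤ (V.card.choose a - 𝒜.card) * q.choose (V.card - b) := by
  set e : Fin V.card ↪o Fin n := V.orderEmbOfFin rfl with he
  let φ : Finset (Fin n) → Finset (Fin V.card) := fun S => univ.filter (fun i => e i ∈ S)
  have hmap : ∀ S ⊆ V, (φ S).map e.toEmbedding = S := by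
    intro S hS
    ext x
    simp only [φ, mem_map, mem_filter, mem_univ, true_and]
    constructor
    · rintro ⟨i, hi, rfl⟩
      exact hi
    · intro hx
      have : x ∈ Set.range e := by
        rw [he, Finset.range_orderEmbOfFin]
        exact hS hx
      obtain ⟨i, rfl⟩ := this
      exact ⟨i, hx, rfl⟩
  have hcard : ∀ (𝒟 : Finset (Finset (Fin n))) (c : ℕ), UniformOn V c 𝒟 →
      (𝒟.image φ).card = 𝒟.card ∧ UniformOn univ c (𝒟.image φ) := by
    intro 𝒟 c h𝒟
    constructor
    · apply card_image_of_injOn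
      intro S hS T hT hST
      rw [← hmap S (h𝒟 S hS).1, ← hmap T (h𝒟 T hT).1]
      exact congrArg _ hST
    · intro S hS
      obtain ⟨T, hT, rfl⟩ := mem_image.1 hS
      refine ⟨subset_univ _, ?_⟩
      rw [← (h𝒟 T hT).2, ← card_map e.toEmbedding, hmap T (h𝒟 T hT).1]
  have hc' : CrossIntersecting 1 (𝒜.image φ) (ℬ.image φ) := by
    intro S hS T hT
    obtain ⟨S, hS', rfl⟩ := mem_image.1 hS
    obtain ⟨T, hT', rfl⟩ := mem_image.1 hT
    have h1 := hc S hS' T hT'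
    rw [← hmap S (h𝒜 S hS').1, ← hmap T (hℬ T hT').1, ← map_inter, card_map] at h1
    exact h1
  have := card_le_or_of_crossIntersecting_univ (q := q) (hcard 𝒜 a h𝒜).2 (hcard ℬ b hℬ).2 hc' hab hq
  rwa [(hcard 𝒜 a h𝒜).1, (hcard ℬ b hℬ).1] at this

/-- Both sides count the `b`-sets containing a fixed `t`-set when `t ≤ b`: the left side by
complements, the right side by the remaining elements. -/
theorem choose_sub_add_eq_chooseSub {m b t : ℕ} (hb : b ≤ m) (ht : t ≤ m) :
    (m - t).choose (m - b) = chooseSub (m - t) b t := by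
  unfold chooseSub
  split_ifs with h
  · rw [← Nat.choose_symm (by omega)]
    congr 1
    omega
  · exact Nat.choose_eq_zero_of_lt (by omega)

/-- If `𝒜` misses fewer `a`-sets than avoid a fixed `t`-set, then a family cross-intersecting with
`𝒜` is no larger than the family of all `b`-sets that contain a fixed `t`-set. -/
theorem card_le_chooseSub_of_crossIntersecting {n a b t : ℕ} {V : Finset (Fin n)}
    {𝒜 ℬ : Finset (Finset (Fin n))}
    (h𝒜 : UniformOn V a 𝒜) (hℬ : UniformOn V b ℬ) (hc : CrossIntersecting 1 𝒜 ℬ)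
    (hab : a + b ≤ V.card) (ht : t ≤ V.card)
    (hbig : V.card.choose a < 𝒜.card + (V.card - t).choose a) :
    ℬ.card ≤ chooseSub (V.card - t) b t := by
  rw [← choose_sub_add_eq_chooseSub (by omega) ht]
  rcases card_le_or_of_crossIntersecting h𝒜 hℬ hc hab (Nat.sub_le _ t) with h | h
  · have := h𝒜.card_le
    omega
  · have h1 : 0 < (V.card - t).choose a := by
      have := h𝒜.card_le
      omega
    apply Nat.le_of_mul_le_mul_right _ h1
    refine h.trans ?_
    rw [mul_comm]
    exact Nat.mul_le_mul_left _ (by omega)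

/-- `m.choose a` exceeds `(m - t).choose a` by at most `t * (m - 1).choose (a - 1)`. -/
theorem choose_le_choose_sub_add {m a : ℕ} : ∀ {t : ℕ}, t ≤ m →
    m.choose a ≤ (m - t).choose a + t * chooseSub (m - 1) a 1 := by
  intro t
  induction t with
  | zero => intro _; simp
  | succ t ih =>
    intro ht
    have h1 := ih (by omega)
    have h2 : (m - t).choose a ≤ (m - (t + 1)).choose a + chooseSub (m - 1) a 1 := by
      rcases a with _ | a
      · simp
      · rw [show m - t = (m - (t + 1)) + 1 by omega, Nat.choose_succ_succ]
        have : chooseSub (m - 1) (a + 1) 1 = (m - 1).choose a := by simp [chooseSub]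
        rw [this, add_comm]
        exact Nat.add_le_add_left (Nat.choose_le_choose _ (by omega)) _
    rw [add_mul, one_mul]
    omega

/-! ### Shifting -/

/-- Replace `j` by `i` in `A`, unless the resulting set is already in the family. -/
def shiftMap (𝒜 : Finset (Finset (Fin n))) (i j : Fin n) (A : Finset (Fin n)) : Finset (Fin n) :=
  if j ∈ A ∧ i ∉ A ∧ insert i (A.erase j) ∉ 𝒜 then insert i (A.erase j) else A

/-- The `(i, j)`-shift of a family. -/
def shift (𝒜 : Finset (Finset (Fin n))) (i j : Fin n) : Finset (Finset (Fin n)) :=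
  𝒜.image (shiftMap 𝒜 i j)

theorem shiftMap_injOn (𝒜 : Finset (Finset (Fin n))) (i j : Fin n) :
    Set.InjOn (shiftMap 𝒜 i j) 𝒜 := by
  intro A hA B hB h
  rw [Finset.mem_coe] at hA hB
  unfold shiftMap at h
  split_ifs at h with h1 h2 h2
  · have h3 : ∀ C : Finset (Fin n), j ∈ C → i ∉ C →
        insert j ((insert i (C.erase j)).erase i) = C := by
      intro C hj hi
      rw [Finset.erase_insert (by simp [hi]), Finset.insert_erase hj]
    rw [← h3 A h1.1 h1.2.1, h, h3 B h2.1 h2.2.1]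
  · exact absurd (h ▸ hB) h1.2.2
  · exact absurd (h ▸ hA) h2.2.2
  · exact h

theorem card_shift (𝒜 : Finset (Finset (Fin n))) (i j : Fin n) :
    (shift 𝒜 i j).card = 𝒜.card :=
  Finset.card_image_of_injOn (shiftMap_injOn 𝒜 i j)

theorem UniformOn.shift {V : Finset (Fin n)} {a : ℕ} {𝒜 : Finset (Finset (Fin n))}
    (h : UniformOn V a 𝒜) {i : Fin n} (hi : i ∈ V) (j : Fin n) :
    UniformOn V a (Diversity.shift 𝒜 i j) := by
  intro S hS
  obtain ⟨A, hA, rfl⟩ := Finset.mem_image.1 hS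
  unfold shiftMap
  split_ifs with h1
  · refine ⟨Finset.insert_subset hi ((Finset.erase_subset _ _).trans (h A hA).1), ?_⟩
    rw [Finset.card_insert_of_notMem (by simp [h1.2.1]), Finset.card_erase_add_one h1.1]
    exact (h A hA).2
  · exact h A hA

theorem crossIntersecting_one_iff {𝒜 ℬ : Finset (Finset (Fin n))} :
    CrossIntersecting 1 𝒜 ℬ ↔ ∀ A ∈ 𝒜, ∀ B ∈ ℬ, ∃ x, x ∈ A ∧ x ∈ B := by
  simp only [CrossIntersecting, Nat.one_le_iff_ne_zero, ← Nat.pos_iff_ne_zero, Finset.card_pos,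
    Finset.Nonempty, Finset.mem_inter]

/-- The critical case is `j ∈ B`, `i ∉ B`: the moved copy of `B` is then also a member, and a point
it shares with `A` is neither `i` nor `j`. -/
theorem exists_mem_of_shift_left {𝒜 ℬ : Finset (Finset (Fin n))} {i j : Fin n}
    (h : ∀ A ∈ 𝒜, ∀ B ∈ ℬ, ∃ x, x ∈ A ∧ x ∈ B) {A B : Finset (Fin n)} (hA : A ∈ 𝒜) (hB : B ∈ ℬ)
    (hi : i ∉ A) (hmove : j ∈ B → i ∉ B → insert i (B.erase j) ∈ ℬ) :
    ∃ x, x ∈ insert i (A.erase j) ∧ x ∈ B := by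
  by_cases hiB : i ∈ B
  · exact ⟨i, by simp, hiB⟩
  by_cases hjB : j ∈ B
  · obtain ⟨x, hxA, hxB⟩ := h A hA _ (hmove hjB hiB)
    simp only [Finset.mem_insert, Finset.mem_erase] at hxB ⊢
    rcases hxB with rfl | hxB
    · exact absurd hxA hi
    · exact ⟨x, Or.inr ⟨hxB.1, hxA⟩, hxB.2⟩
  · obtain ⟨x, hxA, hxB⟩ := h A hA B hB
    refine ⟨x, ?_, hxB⟩
    simp only [Finset.mem_insert, Finset.mem_erase]
    exact Or.inr ⟨by rintro rfl; exact hjB hxB, hxA⟩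

theorem CrossIntersecting.shift {𝒜 ℬ : Finset (Finset (Fin n))} (h : CrossIntersecting 1 𝒜 ℬ)
    (i j : Fin n) : CrossIntersecting 1 (Diversity.shift 𝒜 i j) (Diversity.shift ℬ i j) := by
  rw [crossIntersecting_one_iff] at h ⊢
  intro S hS T hT
  obtain ⟨A, hA, rfl⟩ := Finset.mem_image.1 hS
  obtain ⟨B, hB, rfl⟩ := Finset.mem_image.1 hT
  unfold shiftMap
  split_ifs with h1 h2 h2
  · exact ⟨i, by simp, by simp⟩
  · exact exists_mem_of_shift_left h hA hB h1.2.1 (by tauto)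
  · obtain ⟨x, hx⟩ := exists_mem_of_shift_left (i := i) (j := j) (fun B hB A hA => by
      obtain ⟨x, hx⟩ := h A hA B hB
      exact ⟨x, hx.symm⟩) hB hA h2.2.1 (by tauto)
    exact ⟨x, hx.symm⟩
  · exact h A hA B hB

/-- Shifting towards `i` does not increase the degree of a set that avoids `i`. -/
theorem card_members_shift_le (𝒜 : Finset (Finset (Fin n))) {i : Fin n} (j : Fin n)
    {P : Finset (Fin n)} (hi : i ∉ P) :
    (members (shift 𝒜 i j) P ∅).card ≤ (members 𝒜 P ∅).card := by
  refine (Finset.card_le_card (t := (members 𝒜 P ∅).image (shiftMap 𝒜 i j)) ?_).trans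
    Finset.card_image_le
  intro S hS
  rw [mem_members] at hS
  obtain ⟨A, hA, rfl⟩ := Finset.mem_image.1 hS.1
  refine Finset.mem_image_of_mem _ (mem_members.2 ⟨hA, ?_, Finset.disjoint_empty_right _⟩)
  have h1 := hS.2.1
  unfold shiftMap at h1
  split_ifs at h1
  · intro x hx
    have h2 := h1 hx
    rw [Finset.mem_insert, Finset.mem_erase] at h2
    rcases h2 with rfl | h2
    · exact absurd hx hi
    · exact h2.2
  · exact h1

/-- A set containing `i` after the shift contained `i` or `j` before it. This caps the growth of the
only degree that can increase. -/
theorem card_members_shift_self_le (𝒜 : Finset (Finset (Fin n))) (i j : Fin n) :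
    (members (shift 𝒜 i j) {i} ∅).card ≤ (members 𝒜 {i} ∅).card + (members 𝒜 {j} ∅).card := by
  refine (Finset.card_le_card
    (t := (members 𝒜 {i} ∅ ∪ members 𝒜 {j} ∅).image (shiftMap 𝒜 i j)) ?_).trans
    (Finset.card_image_le.trans (Finset.card_union_le _ _))
  intro S hS
  rw [mem_members] at hS
  obtain ⟨A, hA, rfl⟩ := Finset.mem_image.1 hS.1
  refine Finset.mem_image_of_mem _ ?_
  simp only [Finset.mem_union, mem_members, hA, Finset.singleton_subset_iff,
    Finset.disjoint_empty_right, and_true, true_and]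
  by_contra h1
  push Not at h1
  have h2 := hS.2.1
  rw [shiftMap, if_neg (by tauto)] at h2
  exact h1.1 (by simpa using h2)

theorem members_subset_members_shift (𝒜 : Finset (Finset (Fin n))) (i j : Fin n) :
    members 𝒜 ∅ {i, j} ⊆ members (shift 𝒜 i j) ∅ {i} := by
  intro A hA
  rw [mem_members] at hA ⊢
  simp only [Finset.disjoint_insert_right, Finset.disjoint_singleton_right] at hA ⊢
  refine ⟨Finset.mem_image.2 ⟨A, hA.1, ?_⟩, Finset.empty_subset _, hA.2.2.1⟩
  rw [shiftMap, if_neg (by tauto)]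

/-- The sum of all elements of all members. -/
def weight (𝒜 : Finset (Finset (Fin n))) : ℕ := ∑ A ∈ 𝒜, ∑ x ∈ A, (x : ℕ)

theorem sum_insert_erase_lt {A : Finset (Fin n)} {i j : Fin n} (hij : i < j) (hj : j ∈ A)
    (hi : i ∉ A) : ∑ x ∈ insert i (A.erase j), (x : ℕ) < ∑ x ∈ A, (x : ℕ) := by
  rw [Finset.sum_insert (by simp [hi]), ← Finset.add_sum_erase A _ hj]
  exact Nat.add_lt_add_right hij _

theorem sum_shiftMap_le (𝒜 : Finset (Finset (Fin n))) {i j : Fin n} (hij : i < j)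
    (A : Finset (Fin n)) : ∑ x ∈ shiftMap 𝒜 i j A, (x : ℕ) ≤ ∑ x ∈ A, (x : ℕ) := by
  unfold shiftMap
  split_ifs with h
  · exact (sum_insert_erase_lt hij h.1 h.2.1).le
  · exact le_rfl

theorem weight_shift_le (𝒜 : Finset (Finset (Fin n))) {i j : Fin n} (hij : i < j) :
    weight (shift 𝒜 i j) ≤ weight 𝒜 := by
  rw [weight, shift, Finset.sum_image (shiftMap_injOn 𝒜 i j)]
  exact Finset.sum_le_sum fun A _ => sum_shiftMap_le 𝒜 hij A

theorem weight_shift_lt {𝒜 : Finset (Finset (Fin n))} {i j : Fin n} (hij : i < j)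
    {A : Finset (Fin n)} (hA : A ∈ 𝒜) (hj : j ∈ A) (hi : i ∉ A)
    (hnot : insert i (A.erase j) ∉ 𝒜) : weight (shift 𝒜 i j) < weight 𝒜 := by
  rw [weight, shift, Finset.sum_image (shiftMap_injOn 𝒜 i j)]
  refine Finset.sum_lt_sum (fun A _ => sum_shiftMap_le 𝒜 hij A) ⟨A, hA, ?_⟩
  rw [shiftMap, if_pos ⟨hj, hi, hnot⟩]
  exact sum_insert_erase_lt hij hj hi

theorem exists_of_not_shiftedOn {V : Finset (Fin n)} {𝒜 : Finset (Finset (Fin n))}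
    (h : ¬ ShiftedOn V 𝒜) :
    ∃ i ∈ V, ∃ j ∈ V, i < j ∧ weight (shift 𝒜 i j) < weight 𝒜 := by
  unfold ShiftedOn at h
  push Not at h
  obtain ⟨i, hi, j, hj, hij, A, hA, hjA, hiA, hnot⟩ := h
  exact ⟨i, hi, j, hj, hij, weight_shift_lt hij hA hjA hiA hnot⟩

/-! ### Elements and pairs of large degree -/

theorem chooseSub_succ_left (m a s : ℕ) : chooseSub m (a + 1) (s + 1) = chooseSub m a s :=
  chooseSub_add m a s 1

theorem chooseSub_add_two (m a s : ℕ) : chooseSub m (a + 2) (s + 2) = chooseSub m a s :=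
  chooseSub_add m a s 2

/-- An element of large degree in `𝒜` belongs to almost all members of `ℬ`. -/
theorem card_members_avoid_le {κ : ℕ} {V : Finset (Fin n)} {𝒜 ℬ : Finset (Finset (Fin n))}
    (hV : V.card + 2 = n) (hn : 36 * (κ + 2) ≤ n) (h𝒜 : UniformOn V (κ + 1) 𝒜)
    (hℬ : UniformOn V (κ + 1) ℬ) (hc : CrossIntersecting 1 𝒜 ℬ) {z : Fin n}
    (hz : 4 * chooseSub (n - 2) κ 1 < (members 𝒜 {z} ∅).card) :
    (members ℬ ∅ {z}).card ≤ chooseSub (n - 3) κ 2 := by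
  have hzV : z ∈ V := by
    obtain ⟨A, hA⟩ := Finset.card_pos.1 (Nat.zero_lt_of_lt hz)
    rw [mem_members, Finset.singleton_subset_iff] at hA
    exact (h𝒜 A hA.1).1 hA.2.1
  have hW : (V.erase z).card = n - 3 := by
    rw [Finset.card_erase_of_mem hzV]
    omega
  have u1 := h𝒜.trace (P := {z}) (Q := ∅) (W := V.erase z) (b := κ) (by simp)
    (by ext; simp; tauto)
  have u2 := hℬ.trace (P := ∅) (Q := {z}) (W := V.erase z) (b := κ + 1) (by simp)
    (by ext; simp; tauto)
  have c := hc.trace (s := 1) (P := {z}) (Q := ∅) (P' := ∅) (Q' := {z}) (by simp) (by simp)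
    (by simp) (by simp) (by simp)
  rw [← card_trace] at hz ⊢
  -- The threshold 4 is matched to `t = 4`: C(n-3, κ) exceeds C(n-7, κ) by at most 4E, so the trace
  -- at `z` misses fewer than C(n-7, κ) sets.
  have h1 := choose_le_choose_sub_add (m := n - 3) (a := κ) (t := 4) (by omega)
  have h2 := chooseSub_mono_left (show n - 3 - 1 ≤ n - 2 by omega) κ 1
  have h3 := card_le_chooseSub_of_crossIntersecting (t := 4) u1 u2 c (by omega) (by omega)
    (by rw [hW]; omega)
  rw [hW, chooseSub_succ_left] at h3
  have h4 : chooseSub (n - 3 - 4) κ 3 ≤ _ := chooseSub_diag (n - 3 - 4) κ 2 1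
  have h5 := chooseSub_mono_left (show n - 3 - 4 + 1 ≤ n - 3 by omega) κ 2
  omega

/-- Shifting terminates because `weight` drops. For shifted families, deleting the first element
yields cross-2-intersecting families, one of size at most E, so one of the originals has at most 4E
+ E members. The size bound 17E/2 - T keeps degrees small during shifting: an element of large
degree would have to acquire degree above 8E at once. -/
theorem false_of_small_degrees {κ : ℕ} {V : Finset (Fin n)} (hV : V.card + 2 = n)
    (hn : 36 * (κ + 2) ≤ n) (hT : 36 * chooseSub (n - 3) κ 2 ≤ chooseSub (n - 2) κ 1)
    {𝒜 ℬ : Finset (Finset (Fin n))} (h𝒜 : UniformOn V (κ + 1) 𝒜) (hℬ : UniformOn V (κ + 1) ℬ)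
    (hc : CrossIntersecting 1 𝒜 ℬ)
    (hA : 17 * chooseSub (n - 2) κ 1 < 2 * 𝒜.card + 2 * chooseSub (n - 3) κ 2)
    (hB : 17 * chooseSub (n - 2) κ 1 < 2 * ℬ.card + 2 * chooseSub (n - 3) κ 2)
    (hdA : ∀ z, (members 𝒜 {z} ∅).card ≤ 4 * chooseSub (n - 2) κ 1)
    (hdB : ∀ z, (members ℬ {z} ∅).card ≤ 4 * chooseSub (n - 2) κ 1) : False := by
  induction hw : weight 𝒜 + weight ℬ using Nat.strong_induction_on generalizing 𝒜 ℬ with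
  | _ w ih =>
  subst hw
  by_cases hs : ShiftedOn V 𝒜 ∧ ShiftedOn V ℬ
  · have hne : V.Nonempty := by
      rw [← Finset.card_pos]
      omega
    set v := V.min' hne
    have hv : v ∈ V := V.min'_mem hne
    have hmin : ∀ x ∈ V, v ≤ x := fun x hx => V.min'_le x hx
    have c := hc.succ_of_shifted le_rfl (fun A hA => (h𝒜 A hA).1) hs.1 hv hmin
    have hWe : V \ (∅ ∪ {v}) = V.erase v := by ext; simp; tauto
    have hW : (V.erase v).card = n - 3 := by
      rw [Finset.card_erase_of_mem hv]
      omega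
    have h1 := card_le_or_card_le_of_shifted _ _ _ _ 2 2 _ _
      (h𝒜.trace (b := κ + 1) (by simp) hWe) (hℬ.trace (b := κ + 1) (by simp) hWe)
      (hs.1.trace (by simp) hWe) (hs.2.trace (by simp) hWe) c (by norm_num)
    have e1 := card_eq_trace_add_trace 𝒜 v
    have e2 := card_eq_trace_add_trace ℬ v
    have d1 := hdA v
    have d2 := hdB v
    rw [← card_trace] at d1 d2
    rw [hW, chooseSub_succ_left] at h1
    have h2 := chooseSub_mono_left (show n - 3 ≤ n - 2 by omega) κ 1
    omega
  · have hstep : ∃ i ∈ V, ∃ j, weight (shift 𝒜 i j) + weight (shift ℬ i j) <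
        weight 𝒜 + weight ℬ := by
      rw [not_and_or] at hs
      rcases hs with hs | hs
      · obtain ⟨i, hi, j, -, hij, hlt⟩ := exists_of_not_shiftedOn hs
        exact ⟨i, hi, j, Nat.add_lt_add_of_lt_of_le hlt (weight_shift_le ℬ hij)⟩
      · obtain ⟨i, hi, j, -, hij, hlt⟩ := exists_of_not_shiftedOn hs
        exact ⟨i, hi, j, Nat.add_lt_add_of_le_of_lt (weight_shift_le 𝒜 hij) hlt⟩
    obtain ⟨i, hi, j, hlt⟩ := hstep
    have hA' := card_shift 𝒜 i j
    have hB' := card_shift ℬ i j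
    have u𝒜 := h𝒜.shift hi j
    have uℬ := hℬ.shift hi j
    have c := hc.shift i j
    have key : ∀ 𝒞 𝒟 : Finset (Finset (Fin n)), UniformOn V (κ + 1) (shift 𝒞 i j) →
        UniformOn V (κ + 1) (shift 𝒟 i j) →
        CrossIntersecting 1 (shift 𝒞 i j) (shift 𝒟 i j) →
        17 * chooseSub (n - 2) κ 1 < 2 * 𝒞.card + 2 * chooseSub (n - 3) κ 2 →
        17 * chooseSub (n - 2) κ 1 < 2 * 𝒟.card + 2 * chooseSub (n - 3) κ 2 →
        (∀ z, (members 𝒞 {z} ∅).card ≤ 4 * chooseSub (n - 2) κ 1) →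
        ∀ z, (members (shift 𝒞 i j) {z} ∅).card ≤ 4 * chooseSub (n - 2) κ 1 := by
      intro 𝒞 𝒟 u1 u2 c12 h1 h2 hd z
      by_cases hz : z = i
      · subst hz
        by_contra hlarge
        -- Only the degree of `i` can grow. If it becomes large in one family, at most T members of
        -- the other avoid it, which makes it large there too, and vice versa. Its degree would then
        -- exceed 17E/2 - 2T ≥ 8E, but it is at most 4E + 4E.
        have a1 := card_members_avoid_le hV hn u1 u2 c12 (not_le.1 hlarge)
        have e2 := card_eq_trace_add_trace (shift 𝒟 z j) z
        rw [card_trace, card_trace, card_shift] at e2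
        have a2 := card_members_avoid_le hV hn u2 u1 c12.symm (z := z) (by omega)
        have e1 := card_eq_trace_add_trace (shift 𝒞 z j) z
        rw [card_trace, card_trace, card_shift] at e1
        have d1 := card_members_shift_self_le 𝒞 z j
        have d2 := hd z
        have d3 := hd j
        omega
      · exact (card_members_shift_le 𝒞 j (by simpa using Ne.symm hz)).trans (hd z)
    exact ih _ hlt u𝒜 uℬ c (by rwa [hA']) (by rwa [hB']) (key 𝒜 ℬ u𝒜 uℬ c hA hB hdA)
      (key ℬ 𝒜 uℬ u𝒜 c.symm hB hA hdB) rfl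

/-- Large cross-intersecting families have an element of large degree in common. -/
theorem exists_large_degree {κ : ℕ} {V : Finset (Fin n)} (hV : V.card + 2 = n)
    (hn : 36 * (κ + 2) ≤ n) (hT : 36 * chooseSub (n - 3) κ 2 ≤ chooseSub (n - 2) κ 1)
    {𝒜 ℬ : Finset (Finset (Fin n))} (h𝒜 : UniformOn V (κ + 1) 𝒜) (hℬ : UniformOn V (κ + 1) ℬ)
    (hc : CrossIntersecting 1 𝒜 ℬ)
    (hA : 17 * chooseSub (n - 2) κ 1 < 2 * 𝒜.card + 2 * chooseSub (n - 3) κ 2)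
    (hB : 17 * chooseSub (n - 2) κ 1 < 2 * ℬ.card + 2 * chooseSub (n - 3) κ 2) :
    ∃ z, 4 * chooseSub (n - 2) κ 1 < (members 𝒜 {z} ∅).card ∧
      4 * chooseSub (n - 2) κ 1 < (members ℬ {z} ∅).card := by
  by_contra hno
  push Not at hno
  have key : ∀ 𝒞 𝒟 : Finset (Finset (Fin n)), UniformOn V (κ + 1) 𝒞 → UniformOn V (κ + 1) 𝒟 →
      CrossIntersecting 1 𝒞 𝒟 →
      17 * chooseSub (n - 2) κ 1 < 2 * 𝒟.card + 2 * chooseSub (n - 3) κ 2 → ∀ z,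
      4 * chooseSub (n - 2) κ 1 < (members 𝒞 {z} ∅).card →
      4 * chooseSub (n - 2) κ 1 < (members 𝒟 {z} ∅).card := by
    intro 𝒞 𝒟 u1 u2 c12 h2 z hz
    have a1 := card_members_avoid_le hV hn u1 u2 c12 hz
    have e2 := card_eq_trace_add_trace 𝒟 z
    rw [card_trace, card_trace] at e2
    omega
  refine false_of_small_degrees hV hn hT h𝒜 hℬ hc hA hB (fun z => ?_) (fun z => ?_)
  · by_contra h
    have h1 := key 𝒜 ℬ h𝒜 hℬ hc hB z (not_le.1 h)
    exact absurd (hno z (not_le.1 h)) (not_le.2 h1)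
  · by_contra h
    have h1 := key ℬ 𝒜 hℬ h𝒜 hc.symm hA z (not_le.1 h)
    exact h (hno z h1)

/-- A pair of large degree meets almost all members of an intersecting family. -/
theorem card_members_avoid_pair_le {κ : ℕ} {𝓕 : Finset (Finset (Fin n))}
    (hn : 36 * (κ + 2) ≤ n) (h : UniformOn univ (κ + 2) 𝓕) (hc : CrossIntersecting 1 𝓕 𝓕)
    {x y : Fin n} (hxy : x ≠ y)
    (hlarge : 4 * chooseSub (n - 2) κ 1 < (members 𝓕 {x, y} ∅).card) :
    (members 𝓕 ∅ {x, y}).card ≤ chooseSub (n - 6) κ 2 := by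
  have hV : (univ \ {x, y} : Finset (Fin n)).card = n - 2 := by
    rw [Finset.card_sdiff_of_subset (Finset.subset_univ _), Finset.card_univ, Fintype.card_fin,
      Finset.card_pair hxy]
  have u1 := h.trace (P := {x, y}) (Q := ∅) (W := univ \ {x, y}) (b := κ)
    (by rw [Finset.card_pair hxy]) (by simp)
  have u2 := h.trace (P := ∅) (Q := {x, y}) (W := univ \ {x, y}) (b := κ + 2) (by simp)
    (by simp)
  have c := hc.trace (s := 1) (P := {x, y}) (Q := ∅) (P' := ∅) (Q' := {x, y}) (by simp)
    (by simp) (by simp) (by simp) (by simp)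
  rw [← card_trace] at hlarge ⊢
  have h1 := choose_le_choose_sub_add (m := n - 2) (a := κ) (t := 4) (by omega)
  have h2 := chooseSub_mono_left (show n - 2 - 1 ≤ n - 2 by omega) κ 1
  have h3 := card_le_chooseSub_of_crossIntersecting (t := 4) u1 u2 c (by omega) (by omega)
    (by rw [hV]; omega)
  rwa [hV, chooseSub_add_two, show n - 2 - 4 = n - 6 by omega] at h3

theorem card_eq_four (𝓕 : Finset (Finset (Fin n))) (x y : Fin n) :
    𝓕.card = (members 𝓕 {x, y} ∅).card + (members 𝓕 {x} {y}).card +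
      (members 𝓕 {y} {x}).card + (members 𝓕 ∅ {x, y}).card := by
  have h1 := card_members_split 𝓕 ∅ ∅ x
  have h2 := card_members_split 𝓕 {x} ∅ y
  have h3 := card_members_split 𝓕 ∅ {x} y
  rw [members_empty] at h1
  simp only [insert_empty_eq] at h1 h2 h3
  rw [Finset.pair_comm y x] at h2 h3
  omega

theorem card_members_avoid_eq (𝓕 : Finset (Finset (Fin n))) (x y : Fin n) :
    (members 𝓕 ∅ {x}).card = (members 𝓕 {y} {x}).card + (members 𝓕 ∅ {x, y}).card := by
  have h3 := card_members_split 𝓕 ∅ {x} y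
  simp only [insert_empty_eq] at h3
  rwa [Finset.pair_comm y x] at h3

/-- In an intersecting family of large diversity, any pair of large degree extends to a triangle of
pairs of large degree. -/
theorem exists_triangle {κ : ℕ} {𝓕 : Finset (Finset (Fin n))} (hn : 36 * (κ + 2) ≤ n)
    (hT : 36 * chooseSub (n - 3) κ 2 ≤ chooseSub (n - 2) κ 1)
    (h : UniformOn univ (κ + 2) 𝓕) (hc : CrossIntersecting 1 𝓕 𝓕)
    (hdiv : ∀ x, 17 * chooseSub (n - 2) κ 1 < 2 * (members 𝓕 ∅ {x}).card)
    {x y : Fin n} (hxy : x ≠ y)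
    (hlarge : 4 * chooseSub (n - 2) κ 1 < (members 𝓕 {x, y} ∅).card) :
    ∃ z, z ≠ x ∧ z ≠ y ∧ 4 * chooseSub (n - 2) κ 1 < (members 𝓕 {x, z} ∅).card ∧
      4 * chooseSub (n - 2) κ 1 < (members 𝓕 {y, z} ∅).card := by
  have hV : (univ \ {x, y} : Finset (Fin n)).card + 2 = n := by
    rw [Finset.card_sdiff_of_subset (Finset.subset_univ _), Finset.card_univ, Fintype.card_fin,
      Finset.card_pair hxy]
    omega
  have hpair := card_members_avoid_pair_le hn h hc hxy hlarge
  have hmono := chooseSub_mono_left (show n - 6 ≤ n - 3 by omega) κ 2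
  have u1 := h.trace (P := {x}) (Q := {y}) (W := univ \ {x, y}) (b := κ + 1) (by simp)
    (by ext; simp)
  have u2 := h.trace (P := {y}) (Q := {x}) (W := univ \ {x, y}) (b := κ + 1) (by simp)
    (by ext; simp; tauto)
  have hxy' : ¬ y = x := fun h => hxy h.symm
  have c := hc.trace (s := 1) (P := {x}) (Q := {y}) (P' := {y}) (Q' := {x}) (by simp [hxy])
    (by simp [hxy']) (by simp) (by simp) (by simp [hxy'])
  have e1 := card_members_avoid_eq 𝓕 x y
  have e2 := card_members_avoid_eq 𝓕 y x
  rw [Finset.pair_comm y x] at e2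
  have d1 := hdiv x
  have d2 := hdiv y
  -- At most T members avoid both `x` and `y`, so the diversity bound leaves more than 17E/2 - T
  -- members in each of the two cross-intersecting traces.
  obtain ⟨z, hz1, hz2⟩ := exists_large_degree hV hn hT u1 u2 c
    (by rw [card_trace]; omega) (by rw [card_trace]; omega)
  have hne : ∀ {p q : Fin n}, 4 * chooseSub (n - 2) κ 1 <
      (members (trace 𝓕 {p} {q}) {z} ∅).card → z ≠ p := by
    rintro p q hlt rfl
    obtain ⟨A, hA⟩ := Finset.card_pos.1 (Nat.zero_lt_of_lt hlt)
    rw [mem_members] at hA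
    obtain ⟨B, -, rfl⟩ := Finset.mem_image.1 hA.1
    have := hA.2.1
    simp at this
  have hle : ∀ {p q : Fin n}, z ≠ p →
      (members (trace 𝓕 {p} {q}) {z} ∅).card ≤ (members 𝓕 {p, z} ∅).card := by
    intro p q hzp
    rw [card_members_trace _ (by simpa using hzp.symm) (by simp)]
    exact card_members_mono _ (by rw [← Finset.insert_eq]) (by simp)
  exact ⟨z, hne hz1, hne hz2, hz1.trans_le (hle (hne hz1)), hz2.trans_le (hle (hne hz2))⟩

/-! ### Families without large pairs -/

/-- A shifted intersecting family without pairs of large degree has small diversity. -/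
theorem card_members_avoid_le_of_shifted {κ : ℕ} {𝓕 : Finset (Finset (Fin n))}
    (hn : 36 * (κ + 2) ≤ n) (h : UniformOn univ (κ + 2) 𝓕) (hc : CrossIntersecting 1 𝓕 𝓕)
    (hs : ShiftedOn univ 𝓕)
    (hdeg : ∀ x y, x ≠ y → (members 𝓕 {x, y} ∅).card ≤ 4 * chooseSub (n - 2) κ 1) :
    ∃ v, (members 𝓕 ∅ {v}).card ≤ 6 * chooseSub (n - 2) κ 1 := by
  have hmin : ∀ V : Finset (Fin n), 0 < V.card → ∃ v ∈ V, ∀ x ∈ V, v ≤ x := fun V hV =>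
    ⟨V.min' (Finset.card_pos.1 hV), V.min'_mem _, fun x hx => V.min'_le x hx⟩
  have hU : (univ : Finset (Fin n)).card = n := by simp
  obtain ⟨v, hv, hvmin⟩ := hmin univ (by omega)
  have hV : (univ.erase v : Finset (Fin n)).card = n - 1 := by
    rw [Finset.card_erase_of_mem hv, hU]
  obtain ⟨w, hw, hwmin⟩ := hmin (univ.erase v) (by omega)
  have hW : ((univ.erase v).erase w : Finset (Fin n)).card = n - 2 := by
    rw [Finset.card_erase_of_mem hw, hV]
    omega
  obtain ⟨r, hr, hrmin⟩ := hmin ((univ.erase v).erase w) (by omega)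
  have hR : (((univ.erase v).erase w).erase r : Finset (Fin n)).card = n - 3 := by
    rw [Finset.card_erase_of_mem hr, hW]
    omega
  have hwv : w ≠ v := (Finset.mem_erase.1 hw).1
  have hrw : r ≠ w := (Finset.mem_erase.1 hr).1
  have hrv : r ≠ v := (Finset.mem_erase.1 (Finset.mem_erase.1 hr).2).1
  set 𝒢 := trace 𝓕 ∅ {v} with h𝒢
  have eV : univ \ (∅ ∪ {v}) = univ.erase v := by ext; simp
  have eW : univ.erase v \ (∅ ∪ {w}) = (univ.erase v).erase w := by ext; simp; tauto
  have eW' : univ.erase v \ ({w} ∪ ∅) = (univ.erase v).erase w := by ext; simp; tauto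
  have eR : (univ.erase v).erase w \ (∅ ∪ {r}) = ((univ.erase v).erase w).erase r := by
    ext; simp; tauto
  have u𝒢 : UniformOn (univ.erase v) (κ + 2) 𝒢 := h.trace (by simp) eV
  have s𝒢 : ShiftedOn (univ.erase v) 𝒢 := hs.trace (by simp) eV
  have c𝒢 : CrossIntersecting 2 𝒢 𝒢 :=
    hc.succ_of_shifted le_rfl (fun A _ => Finset.subset_univ A) hs hv hvmin
  -- The three contributions to 6E: members avoiding `v` and `w` give a 3-intersecting family (E);
  -- those containing `w` but not `r` give a 2-intersecting one (E); those containing `w` and `r`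
  -- are bounded by the pair degree (4E).
  have b1 := card_le_or_card_le_of_shifted _ _ _ _ 3 3 _ _
    (u𝒢.trace (b := κ + 2) (by simp) eW) (u𝒢.trace (b := κ + 2) (by simp) eW)
    (s𝒢.trace (by simp) eW) (s𝒢.trace (by simp) eW)
    (c𝒢.succ_of_shifted (by norm_num) (fun A hA => (u𝒢 A hA).1) s𝒢 hw hwmin) (by norm_num)
  have uℋ : UniformOn ((univ.erase v).erase w) (κ + 1) (trace 𝒢 {w} ∅) :=
    u𝒢.trace (by simp) eW'
  have sℋ : ShiftedOn ((univ.erase v).erase w) (trace 𝒢 {w} ∅) := s𝒢.trace (by simp) eW'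
  have cℋ : CrossIntersecting 1 (trace 𝒢 {w} ∅) (trace 𝒢 {w} ∅) :=
    c𝒢.trace (by simp) (by simp) (by simp) (by simp) (by simp)
  have b2 := card_le_or_card_le_of_shifted _ _ _ _ 2 2 _ _
    (uℋ.trace (b := κ + 1) (by simp) eR) (uℋ.trace (b := κ + 1) (by simp) eR)
    (sℋ.trace (by simp) eR) (sℋ.trace (by simp) eR)
    (cℋ.succ_of_shifted le_rfl (fun A hA => (uℋ A hA).1) sℋ hr hrmin) (by norm_num)
  rw [or_self, hW, chooseSub_add_two] at b1
  rw [or_self, hR, chooseSub_succ_left] at b2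
  have e1 := card_eq_trace_add_trace 𝒢 w
  have e2 := card_eq_trace_add_trace (trace 𝒢 {w} ∅) r
  have b3 : (trace (trace 𝒢 {w} ∅) {r} ∅).card ≤ (members 𝓕 {w, r} ∅).card := by
    rw [card_trace, card_members_trace _ (by simpa using hrw.symm) (by simp), h𝒢,
      card_members_trace _ (by simp) (by simp)]
    exact card_members_mono _ (by rw [Finset.empty_union, ← Finset.insert_eq]) (by simp)
  have b4 := hdeg w r hrw.symm
  have b5 := chooseSub_mono_left (show n - 3 ≤ n - 2 by omega) κ 1
  refine ⟨v, ?_⟩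
  rw [← card_trace, ← h𝒢]
  omega

theorem card_univ_sdiff {P : Finset (Fin n)} : (univ \ P : Finset (Fin n)).card = n - P.card := by
  rw [Finset.card_sdiff_of_subset (Finset.subset_univ _), Finset.card_univ, Fintype.card_fin]

set_option maxHeartbeats 1000000 in
/-- If an intersecting family without pairs of large degree is shifted outside `{x, y}` and almost
all members meet `{x, y}`, then almost all members contain `x`. -/
theorem card_members_avoid_le_of_shifted_off_pair {κ : ℕ} {𝓕 : Finset (Finset (Fin n))}
    (hn : 36 * (κ + 2) ≤ n) (hT : 36 * chooseSub (n - 3) κ 2 ≤ chooseSub (n - 2) κ 1)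
    (h : UniformOn univ (κ + 2) 𝓕) (hc : CrossIntersecting 1 𝓕 𝓕)
    (hcard : 33 * chooseSub (n - 2) κ 1 < 𝓕.card)
    (hdeg : ∀ x y, x ≠ y → (members 𝓕 {x, y} ∅).card ≤ 4 * chooseSub (n - 2) κ 1)
    {x y : Fin n} (hxy : x ≠ y) (hs : ShiftedOn (univ \ {x, y}) 𝓕)
    (hpair : 2 * (members 𝓕 ∅ {x, y}).card ≤ 17 * chooseSub (n - 2) κ 1)
    {v : Fin n} (hv : v ∈ univ \ {x, y}) (hvmin : ∀ u ∈ univ \ {x, y}, v ≤ u)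
    (hB : (members 𝓕 {y} {x, v}).card ≤ chooseSub (n - 2) κ 1) :
    2 * (members 𝓕 ∅ {x}).card ≤ 17 * chooseSub (n - 2) κ 1 := by
  have hv' : v ≠ x ∧ v ≠ y := by simpa using hv
  obtain ⟨hvx, hvy⟩ := hv'
  have hxv := hvx.symm
  have hyv := hvy.symm
  have hyx := hxy.symm
  have hV : (univ \ {x, y} : Finset (Fin n)).card = n - 2 := by
    rw [card_univ_sdiff, Finset.card_pair hxy]
  have hW : ((univ \ {x, y}).erase v : Finset (Fin n)).card = n - 3 := by
    rw [Finset.card_erase_of_mem hv, hV]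
    omega
  obtain ⟨w, hw, hwmin⟩ : ∃ w ∈ (univ \ {x, y}).erase v, ∀ u ∈ (univ \ {x, y}).erase v, w ≤ u :=
    ⟨_, Finset.min'_mem _ (Finset.card_pos.1 (by omega)), fun u hu => Finset.min'_le _ u hu⟩
  have hR : (((univ \ {x, y}).erase v).erase w : Finset (Fin n)).card = n - 4 := by
    rw [Finset.card_erase_of_mem hw, hW]
    omega
  have hw' : w ≠ v ∧ w ≠ x ∧ w ≠ y := by simpa using hw
  obtain ⟨hwv, hwx, hwy⟩ := hw'
  have hvw := hwv.symm
  have hxw := hwx.symm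
  have hyw := hwy.symm
  have m3 := chooseSub_mono_left (show n - 3 ≤ n - 2 by omega) κ 1
  have m4 := chooseSub_mono_left (show n - 4 ≤ n - 2 by omega) κ 1
  have m5 := chooseSub_mono_left (show n - 4 ≤ n - 3 by omega) κ 2
  have tV {P Q : Finset (Fin n)} (hPQ : P ∪ Q = {x, y}) (hd : Disjoint P Q) {a : ℕ}
      (ha : κ + 2 = a + P.card) : UniformOn (univ \ {x, y}) a (trace 𝓕 P Q) ∧
        ShiftedOn (univ \ {x, y}) (trace 𝓕 P Q) :=
    ⟨h.trace ha (by rw [hPQ]), hs.trace hd (by rw [hPQ]; ext; simp)⟩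
  have eW : (univ \ {x, y}) \ (∅ ∪ {v}) = (univ \ {x, y}).erase v := by ext; simp; tauto
  have tW {P Q : Finset (Fin n)} (hPQ : P ∪ Q = {x, y, v}) (hd : Disjoint P Q) {a : ℕ}
      (ha : κ + 2 = a + P.card) : UniformOn ((univ \ {x, y}).erase v) a (trace 𝓕 P Q) ∧
        ShiftedOn ((univ \ {x, y}).erase v) (trace 𝓕 P Q) :=
    ⟨h.trace ha (by rw [hPQ]; ext; simp; tauto), hs.trace hd (by rw [hPQ]; ext; simp; tauto)⟩
  have eR : (univ \ {x, y}).erase v \ (∅ ∪ {w}) = ((univ \ {x, y}).erase v).erase w := by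
    ext; simp; tauto
  obtain ⟨uA, sA⟩ := tV (P := {x}) (Q := {y}) (a := κ + 1) rfl (by simp [hxy]) (by simp)
  obtain ⟨uB, sB⟩ := tV (P := {y}) (Q := {x}) (a := κ + 1) (Finset.pair_comm y x)
    (by simp [hyx]) (by simp)
  obtain ⟨uC, sC⟩ := tV (P := ∅) (Q := {x, y}) (a := κ + 2) (by simp) (by simp) (by simp)
  -- At most 4E members contain both `x` and `y`, 17E/2 avoid both, and 4E + E contain `y` only. So
  -- more than 15E contain `x` only, and more than 11E of these avoid `v`. This rules out the first
  -- alternative in every walk bound below.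
  have sum4 := card_eq_four 𝓕 x y
  have dxy := hdeg x y hxy
  have splitB := card_members_split 𝓕 {y} {x} v
  rw [Finset.pair_comm v x] at splitB
  have dyv : (members 𝓕 (insert v {y}) {x}).card ≤ 4 * chooseSub (n - 2) κ 1 :=
    (card_members_mono 𝓕 le_rfl (by simp)).trans (hdeg v y hvy)
  have splitA := card_members_split 𝓕 {x} {y} v
  have dxv : (members 𝓕 (insert v {x}) {y}).card ≤ 4 * chooseSub (n - 2) κ 1 :=
    (card_members_mono 𝓕 le_rfl (by simp)).trans (hdeg v x hvx)
  have tr (P Q : Finset (Fin n)) (hP : Disjoint P {v}) :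
      (trace (trace 𝓕 P Q) ∅ {v}).card = (members 𝓕 P (insert v Q)).card := by
    rw [card_trace, card_members_trace _ (by simp) hP, Finset.union_empty, Finset.union_comm,
      ← Finset.insert_eq]
  have tr' (P Q : Finset (Fin n)) (hP : Disjoint P {w}) :
      (trace (trace 𝓕 P Q) ∅ {w}).card = (members 𝓕 P (insert w Q)).card := by
    rw [card_trace, card_members_trace _ (by simp) hP, Finset.union_empty, Finset.union_comm,
      ← Finset.insert_eq]
  have cAB : CrossIntersecting 1 (trace 𝓕 {x} {y}) (trace 𝓕 {y} {x}) :=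
    hc.trace (by simp [hxy]) (by simp [hyx]) (by simp) (by simp) (by simp [hyx])
  have cAC : CrossIntersecting 1 (trace 𝓕 {x} {y}) (trace 𝓕 ∅ {x, y}) :=
    hc.trace (by simp [hxy]) (by simp) (by simp) (by simp) (by simp)
  -- The parameters are chosen asymmetrically: the parameter 2 on the large side already contradicts
  -- its size, so the other side can take 3 and gets a stronger bound.
  have bB := card_le_or_card_le_of_shifted _ _ _ _ 2 3 _ _ (uA.trace (b := κ + 1) (by simp) eW)
    (uB.trace (b := κ + 1) (by simp) eW) (sA.trace (by simp) eW) (sB.trace (by simp) eW)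
    (cAB.succ_of_shifted le_rfl (fun S hS => (uA S hS).1) sA hv hvmin) (by norm_num)
  rw [tr _ _ (by simp [hxv]), tr _ _ (by simp [hyv]), hW, chooseSub_succ_left,
    chooseSub_succ_left, Finset.pair_comm v x] at bB
  replace bB := bB.resolve_left (by omega)
  have bC := card_le_or_card_le_of_shifted _ _ _ _ 2 3 _ _ (uA.trace (b := κ + 1) (by simp) eW)
    (uC.trace (b := κ + 2) (by simp) eW) (sA.trace (by simp) eW) (sC.trace (by simp) eW)
    (cAC.succ_of_shifted le_rfl (fun S hS => (uA S hS).1) sA hv hvmin) (by norm_num)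
  rw [tr _ _ (by simp [hxv]), tr _ _ (by simp), hW, chooseSub_succ_left,
    chooseSub_add_two] at bC
  replace bC := bC.resolve_left (by omega)
  obtain ⟨uA1, sA1⟩ := tW (P := {x}) (Q := {v, y}) (a := κ + 1)
    (by ext; simp; tauto) (by simp [hxy, hxv]) (by simp)
  obtain ⟨uB1, sB1⟩ := tW (P := {v, y}) (Q := {x}) (a := κ)
    (by ext; simp; tauto) (by simp [hxv, hxy]) (by rw [Finset.card_pair hvy])
  obtain ⟨uC1, sC1⟩ := tW (P := {v}) (Q := {x, y}) (a := κ + 1)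
    (by ext; simp; tauto) (by simp [hvx, hvy]) (by simp)
  have cAB1 : CrossIntersecting 1 (trace 𝓕 {x} {v, y}) (trace 𝓕 {v, y} {x}) :=
    hc.trace (by simp [hxy, hxv]) (by simp [hxv, hxy]) (by simp) (by simp)
      (by rw [Finset.singleton_inter_of_notMem (by simp [hxy, hxv])]; simp)
  have cAC1 : CrossIntersecting 1 (trace 𝓕 {x} {v, y}) (trace 𝓕 {v} {x, y}) :=
    hc.trace (by simp [hxy, hxv]) (by simp [hvx, hvy]) (by simp) (by simp)
      (by rw [Finset.singleton_inter_of_notMem (by simp [hxv])]; simp)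
  have bB1 := card_le_or_card_le_of_shifted _ _ _ _ 2 1 _ _ uA1 uB1 sA1 sB1 cAB1 (by norm_num)
  rw [card_trace, card_trace, hW, chooseSub_succ_left] at bB1
  replace bB1 := bB1.resolve_left (by omega)
  have bC1 := card_le_or_card_le_of_shifted _ _ _ _ 2 3 _ _
    (uA1.trace (b := κ + 1) (by simp) eR) (uC1.trace (b := κ + 1) (by simp) eR)
    (sA1.trace (by simp) eR) (sC1.trace (by simp) eR)
    (cAC1.succ_of_shifted le_rfl (fun S hS => (uA1 S hS).1) sA1 hw hwmin) (by norm_num)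
  rw [tr' _ _ (by simp [hxw]), tr' _ _ (by simp [hvw]), hR, chooseSub_succ_left,
    chooseSub_succ_left] at bC1
  have splitA1 := card_members_split 𝓕 {x} {v, y} w
  have dxw : (members 𝓕 (insert w {x}) {v, y}).card ≤ 4 * chooseSub (n - 2) κ 1 :=
    (card_members_mono 𝓕 le_rfl (by simp)).trans (hdeg w x hwx)
  replace bC1 := bC1.resolve_left (by omega)
  have splitC := card_members_split 𝓕 ∅ {x, y} v
  rw [insert_empty_eq] at splitC
  have splitC1 := card_members_split 𝓕 {v} {x, y} w
  have dvw : (members 𝓕 (insert w {v}) {x, y}).card ≤ 4 * chooseSub (n - 2) κ 1 :=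
    (card_members_mono 𝓕 le_rfl (by simp)).trans (hdeg w v hwv)
  have e1 := card_members_avoid_eq 𝓕 x y
  -- Members avoiding `x`: those with `y` contribute at most E + T, those without `y` at most E + T
  -- + 4E. The total 6E + 2T is at most 17E/2.
  omega

set_option maxHeartbeats 1000000 in
/-- The impossibility of a large intersecting family of large diversity in which all pairs have
small degree. -/
theorem false_of_small_pair_degrees {κ : ℕ} {𝓕 : Finset (Finset (Fin n))}
    (hn : 36 * (κ + 2) ≤ n) (hT : 36 * chooseSub (n - 3) κ 2 ≤ chooseSub (n - 2) κ 1)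
    (h : UniformOn univ (κ + 2) 𝓕) (hc : CrossIntersecting 1 𝓕 𝓕)
    (hcard : 33 * chooseSub (n - 2) κ 1 < 𝓕.card)
    (hdiv : ∀ x, 17 * chooseSub (n - 2) κ 1 < 2 * (members 𝓕 ∅ {x}).card)
    (hdeg : ∀ x y, x ≠ y → (members 𝓕 {x, y} ∅).card ≤ 4 * chooseSub (n - 2) κ 1) :
    False := by
  induction hw : weight 𝓕 using Nat.strong_induction_on generalizing 𝓕 with
  | _ w ih =>
  subst hw
  -- If more than 17E/2 members avoid both `i` and `j`, the shifted family keeps all hypotheses and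
  -- has smaller weight, so the induction hypothesis refutes it.
  have resistant : ∀ i j, i < j → weight (shift 𝓕 i j) < weight 𝓕 →
      2 * (members 𝓕 ∅ {i, j}).card ≤ 17 * chooseSub (n - 2) κ 1 := by
    intro i j hij hlt
    by_contra hbig
    have hu := h.shift (Finset.mem_univ i) j
    have hc' := hc.shift i j
    have hdiv' : ∀ x, 17 * chooseSub (n - 2) κ 1 < 2 * (members (shift 𝓕 i j) ∅ {x}).card := by
      intro x
      by_cases hx : x = i
      · subst hx
        have := Finset.card_le_card (members_subset_members_shift 𝓕 x j)
        omega
      · have h1 := card_eq_trace_add_trace 𝓕 x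
        have h2 := card_eq_trace_add_trace (shift 𝓕 i j) x
        rw [card_trace, card_trace] at h1 h2
        rw [card_shift] at h2
        have h3 := card_members_shift_le 𝓕 j (P := {x}) (by simpa using Ne.symm hx)
        have h4 := hdiv x
        omega
    refine ih _ hlt hu hc' (by rwa [card_shift]) hdiv' (fun x y hxy => ?_) rfl
    by_contra hlarge
    rw [not_le] at hlarge
    obtain ⟨z, hzx, hzy, hxz, hyz⟩ := exists_triangle hn hT hu hc' hdiv' hxy hlarge
    -- A pair that becomes large must contain `i`, but a triangle has a side avoiding `i`.
    have key : ∀ p q, p ≠ q → 4 * chooseSub (n - 2) κ 1 <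
        (members (shift 𝓕 i j) {p, q} ∅).card → i = p ∨ i = q := by
      intro p q hpq hlt
      by_contra hne
      have := card_members_shift_le 𝓕 j (P := {p, q}) (by simpa using hne)
      have := hdeg p q hpq
      omega
    rcases key x y hxy hlarge with rfl | rfl
    · rcases key y z (Ne.symm hzy) hyz with h1 | h1
      · exact hxy h1
      · exact hzx h1.symm
    · rcases key x z (Ne.symm hzx) hxz with h1 | h1
      · exact hxy h1.symm
      · exact hzy h1.symm
  by_cases hs : ShiftedOn univ 𝓕
  · obtain ⟨v, hv⟩ := card_members_avoid_le_of_shifted hn h hc hs hdeg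
    have := hdiv v
    omega
  obtain ⟨x, -, y, -, hlt, hwlt⟩ := exists_of_not_shiftedOn hs
  have hxy : x ≠ y := hlt.ne
  have hpair := resistant x y hlt hwlt
  have hs' : ShiftedOn (univ \ {x, y}) 𝓕 := by
    by_contra hs'
    obtain ⟨i, hi, j, hj, hij, hwij⟩ := exists_of_not_shiftedOn hs'
    have hpair' := resistant i j hij hwij
    have hi' : i ≠ x ∧ i ≠ y := by simpa using hi
    have hj' : j ≠ x ∧ j ≠ y := by simpa using hj
    -- Source of the constant 33: two disjoint resistant pairs would give |𝓕| ≤ 2·(17/2)E + 4·4E =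
    -- 33E.
    have hcover : 𝓕 ⊆ members 𝓕 ∅ {x, y} ∪ members 𝓕 ∅ {i, j} ∪
        (members 𝓕 {x, i} ∅ ∪ members 𝓕 {x, j} ∅) ∪
        (members 𝓕 {y, i} ∅ ∪ members 𝓕 {y, j} ∅) := by
      intro A hA
      simp only [Finset.mem_union, mem_members, hA, Finset.insert_subset_iff,
        Finset.singleton_subset_iff, Finset.disjoint_insert_right,
        Finset.disjoint_singleton_right, Finset.disjoint_empty_right, Finset.empty_subset]
      tauto
    have h1 := Finset.card_le_card hcover
    have h2 := Finset.card_union_le (members 𝓕 ∅ {x, y} ∪ members 𝓕 ∅ {i, j} ∪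
        (members 𝓕 {x, i} ∅ ∪ members 𝓕 {x, j} ∅)) (members 𝓕 {y, i} ∅ ∪ members 𝓕 {y, j} ∅)
    have h3 := Finset.card_union_le (members 𝓕 ∅ {x, y} ∪ members 𝓕 ∅ {i, j})
        (members 𝓕 {x, i} ∅ ∪ members 𝓕 {x, j} ∅)
    have h4 := Finset.card_union_le (members 𝓕 ∅ {x, y}) (members 𝓕 ∅ {i, j})
    have h5 := Finset.card_union_le (members 𝓕 {x, i} ∅) (members 𝓕 {x, j} ∅)
    have h6 := Finset.card_union_le (members 𝓕 {y, i} ∅) (members 𝓕 {y, j} ∅)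
    have h7 := hdeg x i hi'.1.symm
    have h8 := hdeg x j hj'.1.symm
    have h9 := hdeg y i hi'.2.symm
    have h10 := hdeg y j hj'.2.symm
    omega
  have hV : (univ \ {x, y} : Finset (Fin n)).card = n - 2 := by
    rw [card_univ_sdiff, Finset.card_pair hxy]
  obtain ⟨v, hv, hvmin⟩ : ∃ v ∈ univ \ {x, y}, ∀ u ∈ univ \ {x, y}, v ≤ u :=
    ⟨_, Finset.min'_mem _ (Finset.card_pos.1 (by omega)), fun u hu => Finset.min'_le _ u hu⟩
  have hv' : v ≠ x ∧ v ≠ y := by simpa using hv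
  have eW : (univ \ {x, y}) \ (∅ ∪ {v}) = (univ \ {x, y}).erase v := by ext; simp; tauto
  have hW : ((univ \ {x, y}).erase v : Finset (Fin n)).card = n - 3 := by
    rw [Finset.card_erase_of_mem hv, hV]
    omega
  have hyx := hxy.symm
  have uA : UniformOn (univ \ {x, y}) (κ + 1) (trace 𝓕 {x} {y}) := h.trace (by simp) rfl
  have sA : ShiftedOn (univ \ {x, y}) (trace 𝓕 {x} {y}) :=
    hs'.trace (by simp [hxy]) (by ext; simp)
  have uB : UniformOn (univ \ {x, y}) (κ + 1) (trace 𝓕 {y} {x}) :=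
    h.trace (by simp) (by ext; simp; tauto)
  have sB : ShiftedOn (univ \ {x, y}) (trace 𝓕 {y} {x}) :=
    hs'.trace (by simp [hyx]) (by ext; simp; tauto)
  have cAB : CrossIntersecting 1 (trace 𝓕 {x} {y}) (trace 𝓕 {y} {x}) :=
    hc.trace (by simp [hxy]) (by simp [hyx]) (by simp) (by simp) (by simp [hyx])
  have bB := card_le_or_card_le_of_shifted _ _ _ _ 2 2 _ _ (uA.trace (b := κ + 1) (by simp) eW)
    (uB.trace (b := κ + 1) (by simp) eW) (sA.trace (by simp) eW) (sB.trace (by simp) eW)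
    (cAB.succ_of_shifted le_rfl (fun S hS => (uA S hS).1) sA hv hvmin) (by norm_num)
  have tr (p q : Fin n) (hp : v ≠ p) :
      (trace (trace 𝓕 {p} {q}) ∅ {v}).card = (members 𝓕 {p} {q, v}).card := by
    rw [card_trace, card_members_trace _ (by simp) (by simpa using hp.symm), Finset.union_empty,
      ← Finset.insert_eq]
  rw [tr _ _ hv'.1, tr _ _ hv'.2, hW, chooseSub_succ_left] at bB
  have m3 := chooseSub_mono_left (show n - 3 ≤ n - 2 by omega) κ 1
  -- The bound is small on the side of `x` or of `y`; the roles are exchanged accordingly.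
  rcases bB with bB | bB
  · rw [Finset.pair_comm x y] at hpair hs' hv hvmin
    have := card_members_avoid_le_of_shifted_off_pair hn hT h hc hcard hdeg hyx hs' hpair hv hvmin
      (bB.trans m3)
    have := hdiv y
    omega
  · have := card_members_avoid_le_of_shifted_off_pair hn hT h hc hcard hdeg hxy hs' hpair hv hvmin
      (bB.trans m3)
    have := hdiv x
    omega

/-! ### Numerical estimates -/

theorem mul_chooseSub_le {κ : ℕ} (hn : 36 * (κ + 2) ≤ n) :
    36 * chooseSub (n - 3) κ 2 ≤ chooseSub (n - 2) κ 1 := by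
  rcases κ with _ | _ | j
  · simp [chooseSub]
  · simp [chooseSub]
  · have h := Nat.add_one_mul_choose_eq (n - 3) j
    rw [show n - 3 + 1 = n - 2 by omega] at h
    have h1 : chooseSub (n - 3) (j + 1 + 1) 2 = (n - 3).choose j := by simp [chooseSub]
    have h2 : chooseSub (n - 2) (j + 1 + 1) 1 = (n - 2).choose (j + 1) := by simp [chooseSub]
    rw [h1, h2]
    apply Nat.le_of_mul_le_mul_right _ (Nat.succ_pos j)
    rw [Nat.succ_eq_add_one, ← h]
    calc 36 * (n - 3).choose j * (j + 1) = (36 * (j + 1)) * (n - 3).choose j := by ring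
      _ ≤ (n - 2) * (n - 3).choose j := Nat.mul_le_mul_right _ (by omega)

/-- Turns the requirement of diversity above 33E into one in terms of kN/n, the quantity controlled
by n ≥ dk/(1-α). -/
theorem chooseSub_mul_lt {κ : ℕ} (hn : 36 * (κ + 2) ≤ n) :
    33 * (chooseSub (n - 2) κ 1 : ℝ) * n < 36 * (κ + 2) * ((n - 3).choose κ : ℝ) := by
  rcases κ with _ | j
  · simp [chooseSub]
  · obtain ⟨m, rfl⟩ : ∃ m, n = m + 3 := ⟨n - 3, by omega⟩
    have h1 : chooseSub (m + 3 - 2) (j + 1) 1 = (m + 1).choose j := by simp [chooseSub]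
    rw [h1, Nat.add_sub_cancel]
    have e1 := Nat.choose_mul_succ_eq m j
    have e2 := Nat.choose_succ_right_eq m j
    have hc : 0 < m.choose j := Nat.choose_pos (by omega)
    have hmj : j ≤ m := by omega
    rw [← Nat.cast_inj (R := ℝ)] at e1 e2
    rw [Nat.cast_mul, Nat.cast_mul, Nat.cast_sub (by omega)] at e1
    rw [Nat.cast_mul, Nat.cast_mul, Nat.cast_sub hmj] at e2
    push_cast at e1 e2 ⊢
    have hn' : 36 * ((j : ℝ) + 3) ≤ m + 3 := by exact_mod_cast hn
    have hc' : (0 : ℝ) < m.choose j := by exact_mod_cast hc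
    set c : ℝ := (m.choose j : ℝ)
    set a : ℝ := ((m + 1).choose j : ℝ)
    set b : ℝ := (m.choose (j + 1) : ℝ)
    have hj : (0 : ℝ) ≤ j := Nat.cast_nonneg j
    have p1 : (0 : ℝ) < (m : ℝ) + 1 - j := by linarith
    have p2 : (0 : ℝ) < (j : ℝ) + 1 := by linarith
    have ha : a = c * (m + 1) / (m + 1 - j) := by
      rw [eq_div_iff p1.ne']
      exact e1.symm
    have hb : b = c * (m - j) / (j + 1) := by
      rw [eq_div_iff p2.ne']
      exact e2
    rw [ha, hb]
    have key : 33 * ((m : ℝ) + 1) * (m + 3) * (j + 1) <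
        36 * (j + 1 + 2) * (m - j) * (m + 1 - j) := by
      -- The two factors lost are each at least 35/36, and 36·(35/36)² > 34 leaves room above 33.
      have q1 : 35 / 36 * ((m : ℝ) + 3) ≤ m - j := by linarith
      have q2 : 35 / 36 * ((m : ℝ) + 3) ≤ m + 1 - j := by linarith
      have q3 : (0 : ℝ) < m + 3 := by positivity
      have q4 : 35 / 36 * ((m : ℝ) + 3) * (35 / 36 * (m + 3)) ≤ (m - j) * (m + 1 - j) :=
        mul_le_mul q1 q2 (by positivity) (by linarith)
      have q5 : 36 * ((j : ℝ) + 1 + 2) * (35 / 36 * ((m : ℝ) + 3) * (35 / 36 * (m + 3))) ≤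
          36 * (j + 1 + 2) * ((m - j) * (m + 1 - j)) :=
        mul_le_mul_of_nonneg_left q4 (by positivity)
      have q6 : ((m : ℝ) + 1) * (m + 3) * (j + 1) ≤ (m + 3) * (m + 3) * (j + 1 + 2) := by
        gcongr <;> linarith
      have q7 : (0 : ℝ) < (m + 3) * (m + 3) * (j + 1 + 2) := by positivity
      nlinarith
    rw [div_eq_mul_inv, div_eq_mul_inv]
    have := mul_lt_mul_of_pos_left key
      (show 0 < c * ((m : ℝ) + 1 - j)⁻¹ * ((j : ℝ) + 1)⁻¹ by positivity)
    have r1 : ((m : ℝ) + 1 - j) * ((m : ℝ) + 1 - j)⁻¹ = 1 := mul_inv_cancel₀ p1.ne'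
    have r2 : ((j : ℝ) + 1) * ((j : ℝ) + 1)⁻¹ = 1 := mul_inv_cancel₀ p2.ne'
    calc 33 * (c * ((m : ℝ) + 1) * ((m : ℝ) + 1 - j)⁻¹) * (m + 3)
        = 33 * (c * ((m : ℝ) + 1) * ((m : ℝ) + 1 - j)⁻¹) * (m + 3) *
          (((j : ℝ) + 1) * ((j : ℝ) + 1)⁻¹) := by rw [r2, mul_one]
      _ = c * ((m : ℝ) + 1 - j)⁻¹ * ((j : ℝ) + 1)⁻¹ *
          (33 * ((m : ℝ) + 1) * (m + 3) * (j + 1)) := by ring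
      _ < _ := this
      _ = 36 * (↑j + 1 + 2) * (c * (↑m - ↑j) * (↑j + 1)⁻¹) *
          (((m : ℝ) + 1 - j) * ((m : ℝ) + 1 - j)⁻¹) := by ring
      _ = _ := by rw [r1, mul_one]

theorem chooseSub_one_mul_le {κ : ℕ} (hn : 36 * (κ + 2) ≤ n) :
    (chooseSub (n - 3 - 1) κ 1 : ℝ) * n ≤ (κ + 2) * ((n - 3).choose κ : ℝ) := by
  rcases κ with _ | j
  · simp [chooseSub]
  · obtain ⟨m, rfl⟩ : ∃ m, n = m + 4 := ⟨n - 4, by omega⟩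
    have h1 : chooseSub (m + 4 - 3 - 1) (j + 1) 1 = m.choose j := by simp [chooseSub]
    rw [h1, show m + 4 - 3 = m + 1 by omega]
    have e := Nat.add_one_mul_choose_eq m j
    rw [← Nat.cast_inj (R := ℝ)] at e
    push_cast at e ⊢
    have hn' : 36 * ((j : ℝ) + 3) ≤ m + 4 := by exact_mod_cast hn
    have hc : (0 : ℝ) ≤ m.choose j := Nat.cast_nonneg _
    have hj : (0 : ℝ) ≤ j := Nat.cast_nonneg j
    have p : (0 : ℝ) < (j : ℝ) + 1 := by linarith
    apply le_of_mul_le_mul_right _ p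
    calc (m.choose j : ℝ) * (m + 4) * (j + 1) = m.choose j * ((m + 4) * (j + 1)) := by ring
      _ ≤ m.choose j * ((j + 3) * (m + 1)) := by
          apply mul_le_mul_of_nonneg_left _ hc
          nlinarith
      _ = (j + 3) * ((m + 1) * m.choose j) := by ring
      _ = (↑j + 1 + 2) * ↑((m + 1).choose (j + 1)) * (↑j + 1) := by rw [e]; ring

/-- Part of Vandermonde's identity: (r+3)-sets containing all three, or exactly two, of three extra
elements. -/
theorem choose_add_three_ge (q r : ℕ) :
    q.choose r + 3 * q.choose (r + 1) ≤ (q + 3).choose (r + 3) := by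
  simp only [Nat.choose_succ_succ, Nat.succ_eq_add_one]
  omega

/-- The absorption step: a bound on `o` in terms of itself becomes an absolute one. -/
theorem le_of_absorb {o α N M R Q d : ℝ} (hα : 0 ≤ α) (ho : 0 ≤ o) (hM : 0 < M)
    (hR : 0 ≤ R) (hd : 0 ≤ d) (h : o * M ≤ (α * N + o) * R) (hRM : 3 * R ≤ M)
    (hNM : 3 * N ≤ d * M) (hRQ : R ≤ Q) : o ≤ d * α / 2 * Q := by
  -- Since R ≤ M/3, the term o·R is absorbed into the left side, leaving (2/3)·o·M ≤ αNR ≤ αR·dM/3.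
  have h1 : o * (3 * R) ≤ o * M := mul_le_mul_of_nonneg_left hRM ho
  have h2 : α * R * (3 * N) ≤ α * R * (d * M) :=
    mul_le_mul_of_nonneg_left hNM (mul_nonneg hα hR)
  have h3 : o ≤ d * α / 2 * R := by
    apply le_of_mul_le_mul_right _ hM
    nlinarith
  exact h3.trans (mul_le_mul_of_nonneg_left hRQ (by positivity))

/-! ### Diversity and closeness to a triangle family -/

theorem diversity_le (𝓕 : Finset (Finset (Fin n))) (x : Fin n) :
    diversity 𝓕 ≤ (members 𝓕 ∅ {x}).card := by
  have h1 : link 𝓕 x = trace 𝓕 {x} ∅ := by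
    simp [link, trace, members]
  have h2 : (link 𝓕 x).card ≤ maxDegree 𝓕 :=
    Finset.le_sup (f := fun x => (link 𝓕 x).card) (Finset.mem_univ x)
  have h3 := card_eq_trace_add_trace 𝓕 x
  rw [← h1, card_trace] at h3
  unfold diversity
  omega

theorem card_inter_triple {u v w : Fin n} (huv : u ≠ v) (huw : u ≠ w) (hvw : v ≠ w)
    (A : Finset (Fin n)) : (A ∩ {u, v, w}).card =
      (if u ∈ A then 1 else 0) + ((if v ∈ A then 1 else 0) + if w ∈ A then 1 else 0) := by
  rw [Finset.inter_comm, ← Finset.filter_mem_eq_inter, Finset.card_filter,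
    Finset.sum_insert (by simp [huv, huw]), Finset.sum_pair hvw]

/-- The number of members outside the triangle family is bounded by the numbers of members with a
prescribed trace on the triangle. -/
theorem card_sdiff_triangleFamilyStar_le {k : ℕ} {𝓕 : Finset (Finset (Fin n))}
    (h : UniformOn univ k 𝓕) {u v w : Fin n} (huv : u ≠ v) (huw : u ≠ w) (hvw : v ≠ w) :
    (𝓕 \ triangleFamilyStar n k u v w).card ≤ (members 𝓕 ∅ {u, v, w}).card +
      (members 𝓕 {u} {v, w}).card + (members 𝓕 {v} {u, w}).card +
      (members 𝓕 {w} {u, v}).card := by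
  have hcover : 𝓕 \ triangleFamilyStar n k u v w ⊆ members 𝓕 ∅ {u, v, w} ∪
      members 𝓕 {u} {v, w} ∪ members 𝓕 {v} {u, w} ∪ members 𝓕 {w} {u, v} := by
    intro A hA
    rw [Finset.mem_sdiff] at hA
    obtain ⟨hA, hA'⟩ := hA
    simp only [triangleFamilyStar, Finset.mem_filter, Finset.mem_powersetCard, h A hA, and_self,
      true_and, card_inter_triple huv huw hvw] at hA'
    simp only [Finset.mem_union, mem_members, hA, Finset.singleton_subset_iff,
      Finset.disjoint_insert_right, Finset.disjoint_singleton_right, Finset.empty_subset, true_and]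
    by_cases hu : u ∈ A <;> by_cases hv : v ∈ A <;> by_cases hw : w ∈ A <;>
      simp [hu, hv, hw] at hA' ⊢
  refine (Finset.card_le_card hcover).trans ((Finset.card_union_le _ _).trans ?_)
  refine Nat.add_le_add_right ((Finset.card_union_le _ _).trans ?_) _
  exact Nat.add_le_add_right (Finset.card_union_le _ _) _

/-- Almost all members that avoid `u` contain both other vertices of the triangle. -/
theorem card_members_avoid_le_add {k : ℕ} {𝓕 : Finset (Finset (Fin n))} {u v w : Fin n}
    (huv : u ≠ v) (huw : u ≠ w) (hvw : v ≠ w) {p q r : Fin n}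
    (hpqr : p = u ∧ q = v ∧ r = w ∨ p = v ∧ q = u ∧ r = w ∨ p = w ∧ q = u ∧ r = v) :
    (members 𝓕 ∅ {p}).card ≤ (members 𝓕 {q, r} {p}).card +
      (𝓕 \ triangleFamilyStar n k u v w).card := by
  refine (Finset.card_le_card ?_).trans (Finset.card_union_le _ _)
  intro A hA
  simp only [mem_members, Finset.disjoint_singleton_right] at hA
  simp only [Finset.mem_union, mem_members, Finset.disjoint_singleton_right, hA, true_and,
    not_false_eq_true, and_true, Finset.mem_sdiff, triangleFamilyStar, Finset.mem_filter,
    card_inter_triple huv huw hvw, Finset.insert_subset_iff, Finset.singleton_subset_iff]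
  have hA' := hA.2.2
  rcases hpqr with ⟨rfl, rfl, rfl⟩ | ⟨rfl, rfl, rfl⟩ | ⟨rfl, rfl, rfl⟩ <;>
    by_cases hq : q ∈ A <;> by_cases hr : r ∈ A <;> simp [hA', hq, hr]

/-- The number of sets missing from the triangle family. -/
theorem card_triangleFamily_sdiff_le {κ : ℕ} {𝓕 : Finset (Finset (Fin n))}
    (h : UniformOn univ (κ + 2) 𝓕) {u v w : Fin n} (huv : u ≠ v) (huw : u ≠ w) (hvw : v ≠ w) :
    (triangleFamily n (κ + 2) u v w \ 𝓕).card ≤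
      ((n - 3).choose κ - (members 𝓕 {v, w} {u}).card) +
      ((n - 3).choose κ - (members 𝓕 {u, w} {v}).card) +
      ((n - 3).choose κ - (members 𝓕 {u, v} {w}).card) := by
  set 𝒦 : Finset (Finset (Fin n)) := univ.powersetCard (κ + 2)
  have h𝒦 : UniformOn univ (κ + 2) 𝒦 := fun A hA => Finset.mem_powersetCard.1 hA
  have hsub : 𝓕 ⊆ 𝒦 := fun A hA => Finset.mem_powersetCard.2 (h A hA)
  have hone : ∀ p q r : Fin n, q ≠ r → p ≠ q → p ≠ r →
      (members 𝒦 {q, r} {p} \ 𝓕).card ≤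
        (n - 3).choose κ - (members 𝓕 {q, r} {p}).card := by
    intro p q r hqr hpq hpr
    have h1 := (h𝒦.trace (P := {q, r}) (Q := {p}) (b := κ) (by rw [Finset.card_pair hqr])
      rfl).card_le
    have h2 : ({q, r} ∪ {p} : Finset (Fin n)).card = 3 := by
      rw [Finset.card_union_of_disjoint (by simp [hpq, hpr]), Finset.card_pair hqr,
        Finset.card_singleton]
    rw [card_trace, card_univ_sdiff, h2] at h1
    have h3 : members 𝒦 {q, r} {p} \ 𝓕 = members 𝒦 {q, r} {p} \ members 𝓕 {q, r} {p} := by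
      ext A
      simp only [Finset.mem_sdiff, mem_members]
      tauto
    have h4 : members 𝓕 {q, r} {p} ⊆ members 𝒦 {q, r} {p} := by
      intro A hA
      rw [mem_members] at hA ⊢
      exact ⟨hsub hA.1, hA.2⟩
    rw [h3, Finset.card_sdiff_of_subset h4]
    omega
  have hcover : triangleFamily n (κ + 2) u v w \ 𝓕 ⊆ (members 𝒦 {v, w} {u} \ 𝓕) ∪
      (members 𝒦 {u, w} {v} \ 𝓕) ∪ (members 𝒦 {u, v} {w} \ 𝓕) := by
    intro A hA
    rw [Finset.mem_sdiff, triangleFamily, Finset.mem_filter,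
      card_inter_triple huv huw hvw] at hA
    obtain ⟨⟨hA, hcard⟩, hA'⟩ := hA
    have hA2 : A ∈ 𝒦 := hA
    simp only [Finset.mem_union, Finset.mem_sdiff, mem_members, hA2, hA', not_false_eq_true,
      and_true, Finset.insert_subset_iff, Finset.singleton_subset_iff,
      Finset.disjoint_singleton_right, true_and]
    by_cases hu : u ∈ A <;> by_cases hv : v ∈ A <;> by_cases hw : w ∈ A <;>
      simp [hu, hv, hw] at hcard ⊢
  refine (Finset.card_le_card hcover).trans ((Finset.card_union_le _ _).trans ?_)
  exact Nat.add_le_add ((Finset.card_union_le _ _).trans (Nat.add_le_add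
    (hone u v w hvw huv huw) (hone v u w huw huv.symm hvw)))
    (hone w u v huv huw.symm hvw.symm)

/-- An intersecting family of large diversity has a triangle of pairs of large degree. -/
theorem exists_triangle_of_diversity {κ : ℕ} {𝓕 : Finset (Finset (Fin n))}
    (hn : 36 * (κ + 2) ≤ n) (h : UniformOn univ (κ + 2) 𝓕) (hc : CrossIntersecting 1 𝓕 𝓕)
    (hdiv : ∀ x, 33 * chooseSub (n - 2) κ 1 < (members 𝓕 ∅ {x}).card) :
    ∃ u v w, u ≠ v ∧ u ≠ w ∧ v ≠ w ∧ 4 * chooseSub (n - 2) κ 1 < (members 𝓕 {u, v} ∅).card ∧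
      4 * chooseSub (n - 2) κ 1 < (members 𝓕 {u, w} ∅).card ∧
      4 * chooseSub (n - 2) κ 1 < (members 𝓕 {v, w} ∅).card := by
  have hT := mul_chooseSub_le hn
  have hdiv' : ∀ x, 17 * chooseSub (n - 2) κ 1 < 2 * (members 𝓕 ∅ {x}).card := fun x => by
    have := hdiv x
    omega
  have hpair : ∃ u v, u ≠ v ∧ 4 * chooseSub (n - 2) κ 1 < (members 𝓕 {u, v} ∅).card := by
    by_contra hno
    push Not at hno
    refine false_of_small_pair_degrees hn hT h hc ?_ hdiv' hno
    have x : Fin n := ⟨0, by omega⟩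
    exact (hdiv x).trans_le (Finset.card_le_card (Finset.filter_subset _ _))
  obtain ⟨u, v, huv, hlarge⟩ := hpair
  obtain ⟨w, hwu, hwv, huw', hvw'⟩ := exists_triangle hn hT h hc hdiv' huv hlarge
  exact ⟨u, v, w, huv, hwu.symm, hwv.symm, hlarge, huw', hvw'⟩

/-- Members with the trace `P'` on a three-element set `P ∪ Q` are few, in proportion to the number
of sets with the disjoint trace `P` that are missing from the family. -/
theorem card_members_mul_choose_le {κ b q : ℕ} {𝓕 : Finset (Finset (Fin n))}
    (hn : 36 * (κ + 2) ≤ n) (h : UniformOn univ (κ + 2) 𝓕) (hc : CrossIntersecting 1 𝓕 𝓕)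
    {P Q P' Q' : Finset (Fin n)} (hPQ : Disjoint P Q) (hPQ' : Disjoint P' Q')
    (hPP : Disjoint P P') (hun : P ∪ Q = P' ∪ Q') (hcard : (P ∪ Q).card = 3) (hP : P.card = 2)
    (hb : κ + 2 = b + P'.card) (hq : q ≤ n - 3)
    (hmiss : (n - 3).choose κ - (members 𝓕 P Q).card < q.choose κ) :
    (members 𝓕 P' Q').card * q.choose κ ≤
      ((n - 3).choose κ - (members 𝓕 P Q).card) * q.choose (n - 3 - b) := by
  have hV : (univ \ (P ∪ Q) : Finset (Fin n)).card = n - 3 := by rw [card_univ_sdiff, hcard]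
  have c : CrossIntersecting 1 (trace 𝓕 P Q) (trace 𝓕 P' Q') :=
    hc.trace hPQ hPQ' (hun ▸ Finset.subset_union_left) (hun ▸ Finset.subset_union_left)
      (by rw [Finset.disjoint_iff_inter_eq_empty.1 hPP, Finset.card_empty])
  have h1 := card_le_or_of_crossIntersecting (q := q) (h.trace (b := κ) (by rw [hP]) rfl)
    (h.trace (b := b) hb (by rw [hun])) c (by omega) (by omega)
  rw [hV, card_trace, card_trace] at h1
  exact h1.resolve_left (not_le.2 hmiss)

set_option maxHeartbeats 1000000 in
/-- An intersecting family of large diversity is close to the triangle family of some triple: the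
first bound controls its members outside, the second the sets missing from it. -/
theorem exists_triangle_approximation {κ D : ℕ} {𝓕 : Finset (Finset (Fin n))} {α : ℝ}
    (hD : 36 ≤ D) (hα0 : 0 ≤ α) (hn : (D : ℝ) * (κ + 2) ≤ (1 - α) * n)
    (h : UniformOn univ (κ + 2) 𝓕) (hc : CrossIntersecting 1 𝓕 𝓕)
    (hdiv : ∀ x, (1 - α) * ((n - 3).choose κ : ℝ) ≤ (members 𝓕 ∅ {x}).card) :
    ∃ u v w : Fin n, u ≠ v ∧ u ≠ w ∧ v ≠ w ∧
      ((𝓕 \ triangleFamilyStar n (κ + 2) u v w).card : ℝ) ≤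
        D * α / 2 * (n - (D - 3)).choose (n - (κ + 2)) ∧
      ((triangleFamily n (κ + 2) u v w \ 𝓕).card : ℝ) ≤ 3 * (α * (n - 3).choose κ) +
        3 * (𝓕 \ triangleFamilyStar n (κ + 2) u v w).card := by
  have hDR : (36 : ℝ) ≤ D := by exact_mod_cast hD
  have hDn : D * (κ + 2) ≤ n := by
    have : (D : ℝ) * (κ + 2) ≤ n := hn.trans (by
      have : (0 : ℝ) ≤ n := Nat.cast_nonneg n
      nlinarith)
    exact_mod_cast this
  have hn36 : 36 * (κ + 2) ≤ n := (Nat.mul_le_mul_right _ hD).trans hDn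
  have hD2 : 2 * D ≤ n := by nlinarith
  have hn0 : (0 : ℝ) < n := by
    have : 0 < n := by omega
    exact_mod_cast this
  set N : ℝ := ((n - 3).choose κ : ℝ) with hN
  have hN0 : 0 < N := by
    have : 0 < (n - 3).choose κ := Nat.choose_pos (by omega)
    rw [hN]
    exact_mod_cast this
  -- U = kN/n is the common unit: the assumption on n reads D·U ≤ (1-α)N, and the error terms are
  -- multiples of U.
  set U : ℝ := (κ + 2) * N / n with hU
  have hUn : U * n = (κ + 2) * N := by rw [hU, div_mul_cancel₀ _ hn0.ne']
  have hU0 : 0 < U := by positivity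
  have hDU : D * U ≤ (1 - α) * N := by
    apply le_of_mul_le_mul_right _ hn0
    calc (D : ℝ) * U * n = D * (κ + 2) * N := by rw [mul_assoc, hUn]; ring
      _ ≤ (1 - α) * n * N := mul_le_mul_of_nonneg_right hn hN0.le
      _ = (1 - α) * N * n := by ring
  have hEU : 33 * (chooseSub (n - 2) κ 1 : ℝ) < 36 * U := by
    apply lt_of_mul_lt_mul_right _ hn0.le
    calc 33 * (chooseSub (n - 2) κ 1 : ℝ) * n < 36 * (κ + 2) * N := chooseSub_mul_lt hn36
      _ = 36 * U * n := by rw [mul_assoc 36 U, hUn]; ring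
  have hTE : 36 * (chooseSub (n - 3) κ 2 : ℝ) ≤ chooseSub (n - 2) κ 1 := by
    exact_mod_cast mul_chooseSub_le hn36
  obtain ⟨u, v, w, huv, huw, hvw, luv, luw, lvw⟩ := exists_triangle_of_diversity hn36 h hc
    (fun x => by
      have h1 : 33 * (chooseSub (n - 2) κ 1 : ℝ) < (members 𝓕 ∅ {x}).card := by
        have := hdiv x
        nlinarith
      exact_mod_cast h1)
  refine ⟨u, v, w, huv, huw, hvw, ?_⟩
  have hvu := huv.symm
  have hwu := huw.symm
  have hwv := hvw.symm
  set o := (𝓕 \ triangleFamilyStar n (κ + 2) u v w).card with ho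
  have hsplit := card_sdiff_triangleFamilyStar_le h huv huw hvw
  rw [← ho] at hsplit
  have ho3U : (o : ℝ) < 3 * U := by
    have b1 := card_members_avoid_pair_le hn36 h hc huv luv
    have b2 := card_members_avoid_pair_le hn36 h hc huw luw
    have b3 := card_members_avoid_pair_le hn36 h hc hvw lvw
    have b0 : (members 𝓕 ∅ {u, v, w}).card + (members 𝓕 {w} {u, v}).card ≤
        (members 𝓕 ∅ {u, v}).card := by
      have h1 := card_members_split 𝓕 ∅ {u, v} w
      rw [insert_empty_eq, show ({w, u, v} : Finset (Fin n)) = {u, v, w} by ext; simp; tauto] at h1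
      omega
    have b4 : (members 𝓕 {v} {u, w}).card ≤ (members 𝓕 ∅ {u, w}).card :=
      card_members_mono 𝓕 (by simp) le_rfl
    have b5 : (members 𝓕 {u} {v, w}).card ≤ (members 𝓕 ∅ {v, w}).card :=
      card_members_mono 𝓕 (by simp) le_rfl
    have b6 := chooseSub_mono_left (show n - 6 ≤ n - 3 by omega) κ 2
    have b7 : o ≤ 3 * chooseSub (n - 3) κ 2 := by omega
    have b8 : (o : ℝ) ≤ 3 * chooseSub (n - 3) κ 2 := by exact_mod_cast b7
    linarith
  have hmiss : ∀ p q r : Fin n,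
      (p = u ∧ q = v ∧ r = w ∨ p = v ∧ q = u ∧ r = w ∨ p = w ∧ q = u ∧ r = v) →
      (((n - 3).choose κ - (members 𝓕 {q, r} {p}).card : ℕ) : ℝ) ≤ α * N + o := by
    intro p q r hpqr
    have h1 := card_members_avoid_le_add (k := κ + 2) (𝓕 := 𝓕) huv huw hvw hpqr
    rw [← ho] at h1
    have h2 := hdiv p
    have h3 : ((members 𝓕 ∅ {p}).card : ℝ) ≤ (members 𝓕 {q, r} {p}).card + o := by
      exact_mod_cast h1
    rcases le_total ((n - 3).choose κ) (members 𝓕 {q, r} {p}).card with h4 | h4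
    · rw [Nat.sub_eq_zero_of_le h4, Nat.cast_zero]
      positivity
    · rw [Nat.cast_sub h4]
      linarith
  have mu := hmiss u v w (Or.inl ⟨rfl, rfl, rfl⟩)
  have mv := hmiss v u w (Or.inr (Or.inl ⟨rfl, rfl, rfl⟩))
  have mw := hmiss w u v (Or.inr (Or.inr ⟨rfl, rfl, rfl⟩))
  constructor
  -- Kruskal–Katona is used with q = n - D. The number M of κ-subsets of a q-set stays above αN +
  -- 3U, hence above the number αN + o of missing sets.
  · set M : ℝ := ((n - D).choose κ : ℝ) with hM
    have hMN : N - (D - 3) * U ≤ M := by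
      have h1 := choose_le_choose_sub_add (m := n - 3) (a := κ) (t := D - 3) (by omega)
      rw [show n - 3 - (D - 3) = n - D by omega] at h1
      have h2 : N ≤ M + (D - 3) * (chooseSub (n - 3 - 1) κ 1 : ℝ) := by
        have : ((D - 3 : ℕ) : ℝ) = D - 3 := by
          rw [Nat.cast_sub (by omega)]
          norm_num
        rw [← this, hN, hM]
        exact_mod_cast h1
      have h3 : (chooseSub (n - 3 - 1) κ 1 : ℝ) ≤ U := by
        apply le_of_mul_le_mul_right _ hn0
        rw [hUn]
        exact chooseSub_one_mul_le hn36
      nlinarith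
    have hM1 : α * N + 3 * U ≤ M := by linarith
    have hM0 : 0 < M := by
      have : 0 ≤ α * N := by positivity
      linarith
    have hNM : 3 * N ≤ D * M := by
      have h1 : (D : ℝ) * (N - (D - 3) * U) ≤ D * M :=
        mul_le_mul_of_nonneg_left hMN (by positivity)
      have h2 : D * U ≤ N := hDU.trans (by nlinarith)
      have h3 : ((D : ℝ) - 3) * (D * U) ≤ (D - 3) * N :=
        mul_le_mul_of_nonneg_left h2 (by linarith)
      linarith
    set r := n - 3 - (κ + 2) with hr
    have hbound : ∀ (p s t : Fin n) (b : ℕ) (P' Q' : Finset (Fin n)), p ≠ s → p ≠ t → s ≠ t →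
        (((n - 3).choose κ - (members 𝓕 {s, t} {p}).card : ℕ) : ℝ) ≤ α * N + o →
        Disjoint P' Q' → Disjoint {s, t} P' → {s, t} ∪ {p} = P' ∪ Q' → κ + 2 = b + P'.card →
        ((members 𝓕 P' Q').card : ℝ) * M ≤ (α * N + o) * (n - D).choose (n - 3 - b) := by
      intro p s t b P' Q' hps hpt hst hm hPQ' hPP hun hb
      have hd : Disjoint ({s, t} : Finset (Fin n)) {p} := by simp [hps, hpt]
      have h1 := card_members_mul_choose_le (q := n - D) hn36 h hc hd hPQ' hPP hun
        (by rw [Finset.card_union_of_disjoint hd, Finset.card_pair hst, Finset.card_singleton])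
        (Finset.card_pair hst) hb (by omega) (by
          have : (((n - 3).choose κ - (members 𝓕 {s, t} {p}).card : ℕ) : ℝ) < M := by linarith
          rw [hM] at this
          exact_mod_cast this)
      calc ((members 𝓕 P' Q').card : ℝ) * M
          ≤ (((n - 3).choose κ - (members 𝓕 {s, t} {p}).card : ℕ) : ℝ) *
            (n - D).choose (n - 3 - b) := by
            rw [hM]
            exact_mod_cast h1
        _ ≤ _ := mul_le_mul_of_nonneg_right hm (Nat.cast_nonneg _)
    have b0 := hbound u v w (κ + 2) ∅ {u, v, w} huv huw hvw mu (by simp) (by simp)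
      (by ext; simp; tauto) (by simp)
    have b1 := hbound u v w (κ + 1) {u} {v, w} huv huw hvw mu (by simp [huv, huw])
      (by simp [huv, huw]) (by ext; simp; tauto) (by simp)
    have b2 := hbound v u w (κ + 1) {v} {u, w} hvu hvw huw mv (by simp [hvu, hvw])
      (by simp [hvu, hvw]) (by ext; simp; tauto) (by simp)
    have b3 := hbound w u v (κ + 1) {w} {u, v} hwu hwv huv mw (by simp [hwu, hwv])
      (by simp [hwu, hwv]) (by ext; simp; tauto) (by simp)
    rw [← hr] at b0
    rw [show n - 3 - (κ + 1) = r + 1 by omega] at b1 b2 b3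
    have hsplitR : (o : ℝ) ≤ (members 𝓕 ∅ {u, v, w}).card + (members 𝓕 {u} {v, w}).card +
        (members 𝓕 {v} {u, w}).card + (members 𝓕 {w} {u, v}).card := by exact_mod_cast hsplit
    -- R sums the bounds for the four outside traces: one empty and three singletons. It is at most
    -- C(n-D+3, n-k), the binomial coefficient in the theorem, and that is at most U.
    have hRQ : ((n - D).choose r : ℝ) + 3 * (n - D).choose (r + 1) ≤
        (n - (D - 3)).choose (n - (κ + 2)) := by
      have h1 := choose_add_three_ge (n - D) r
      rw [show n - D + 3 = n - (D - 3) by omega, show r + 3 = n - (κ + 2) by omega] at h1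
      exact_mod_cast h1
    have hQU : ((n - (D - 3)).choose (n - (κ + 2)) : ℝ) ≤ U := by
      have h1 : (n - (D - 3)).choose (n - (κ + 2)) ≤ chooseSub (n - 3) κ 2 := by
        rw [choose_sub_add_eq_chooseSub (by omega) (by omega)]
        have h2 := chooseSub_diag (n - (D - 3)) (κ + 2) 4 (D - 7)
        rw [show 4 + (D - 7) = D - 3 by omega, chooseSub_add_two] at h2
        exact h2.trans (chooseSub_mono_left (by omega) κ 2)
      have h2 : ((n - (D - 3)).choose (n - (κ + 2)) : ℝ) ≤ chooseSub (n - 3) κ 2 := by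
        exact_mod_cast h1
      linarith
    have hαN : 0 ≤ α * N := by positivity
    refine le_of_absorb (N := N) (M := M)
      (R := ((n - D).choose r : ℝ) + 3 * (n - D).choose (r + 1)) hα0 (Nat.cast_nonneg _) hM0
      (by positivity) (by positivity) ?_ (by linarith) hNM hRQ
    have := mul_le_mul_of_nonneg_right hsplitR hM0.le
    linarith
  · have h1 := card_triangleFamily_sdiff_le h huv huw hvw
    have h2 : ((triangleFamily n (κ + 2) u v w \ 𝓕).card : ℝ) ≤
        (((n - 3).choose κ - (members 𝓕 {v, w} {u}).card : ℕ) : ℝ) +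
        (((n - 3).choose κ - (members 𝓕 {u, w} {v}).card : ℕ) : ℝ) +
        (((n - 3).choose κ - (members 𝓕 {u, v} {w}).card : ℕ) : ℝ) := by exact_mod_cast h1
    linarith

end Diversity

theorem theorem1p11 (n k : ℕ) (hk : 2 ≤ k) (𝓕 : Finset (Finset (Fin n)))
    (hunif : (𝓕 : Set (Finset (Fin n))).Sized k)
    (hint : (𝓕 : Set (Finset (Fin n))).Intersecting)
    (α : ℝ)
    (hα : (Diversity.diversity 𝓕 : ℝ) =
      (1 - α) * (Diversity.binom ((n : ℤ) - 3) ((k : ℤ) - 2) : ℝ))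
    (d : ℤ) (hd : 36 ≤ d) (hα0 : 0 ≤ α) (hα1 : α < 1)
    (hn : (n : ℝ) ≥ (d : ℝ) * (k : ℝ) / (1 - α)) :
    ∃ u v w : Fin n, u ≠ v ∧ u ≠ w ∧ v ≠ w ∧
      ((𝓕 \ Diversity.triangleFamilyStar n k u v w).card : ℝ) ≤
        (d : ℝ) * α / 2 * (Diversity.binom ((n : ℤ) - d + 3) ((k : ℤ) - d + 3) : ℝ) ∧
      ((Diversity.triangleFamily n k u v w \ 𝓕).card : ℝ) ≤
        3 * α * (Diversity.binom ((n : ℤ) - 3) ((k : ℤ) - 2) : ℝ) +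
          3 * (d : ℝ) * α / 2 *
            (Diversity.binom ((n : ℤ) - d + 3) ((k : ℤ) - d + 3) : ℝ) := by
  obtain ⟨κ, rfl⟩ : ∃ κ, k = κ + 2 := ⟨k - 2, by omega⟩
  obtain ⟨D, rfl⟩ : ∃ D : ℕ, d = D := ⟨d.toNat, by omega⟩
  have hD : 36 ≤ D := by exact_mod_cast hd
  have hn' : (D : ℝ) * (κ + 2) ≤ (1 - α) * n := by
    have h1 : (0 : ℝ) < 1 - α := by linarith
    rw [ge_iff_le, div_le_iff₀ h1] at hn
    push_cast at hn
    linarith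
  have hDn : D * (κ + 2) ≤ n := by
    have : (D : ℝ) * (κ + 2) ≤ n := hn'.trans (by
      have : (0 : ℝ) ≤ n := Nat.cast_nonneg n
      nlinarith)
    exact_mod_cast this
  have hD2 : 2 * D ≤ n := by nlinarith
  have hk36 : 36 * (κ + 2) ≤ n := (Nat.mul_le_mul_right _ hD).trans hDn
  have hbN : Diversity.binom ((n : ℤ) - 3) (((κ + 2 : ℕ) : ℤ) - 2) = ((n - 3).choose κ : ℤ) := by
    rw [← Diversity.binom_natCast]
    congr 1 <;> omega
  have hbQ : Diversity.binom ((n : ℤ) - (D : ℤ) + 3) (((κ + 2 : ℕ) : ℤ) - (D : ℤ) + 3) =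
      ((n - (D - 3)).choose (n - (κ + 2)) : ℤ) := by
    -- Passing to the complementary lower entry n - k covers the case k < d - 3 as well, where both
    -- sides vanish.
    rw [Diversity.choose_sub_add_eq_chooseSub (by omega) (by omega), Diversity.chooseSub]
    split_ifs with h
    · rw [← Diversity.binom_natCast]
      congr 1 <;> omega
    · rw [Diversity.binom_of_neg _ (by omega), Nat.cast_zero]
  rw [hbN, Int.cast_natCast] at hα
  rw [hbN, hbQ, Int.cast_natCast, Int.cast_natCast, Int.cast_natCast]
  obtain ⟨u, v, w, huv, huw, hvw, h1, h2⟩ := Diversity.exists_triangle_approximation hD hα0 hn'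
    (𝓕 := 𝓕) (fun A hA => ⟨Finset.subset_univ A, hunif hA⟩)
    (Diversity.crossIntersecting_one_iff.2 fun A hA B hB =>
      Finset.not_disjoint_iff.1 (hint hA hB))
    (fun x => by
      rw [← hα]
      exact_mod_cast Diversity.diversity_le 𝓕 x)
  exact ⟨u, v, w, huv, huw, hvw, h1, by linarith⟩
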